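/- **Setting.** Let $\mathbb S=\mathbb D/G$ and $\mathbb S_*=\mathbb D/G_*$, where $G,G_*$ are groups of fractional linear automorphisms of the unit disc $\mathbb D$ without fixed points in $\mathbb D$ and acting discontinuously in $\mathbb D$. On $\mathbb D$ take the hyperbolic metric $h(z_1,z_2)=\log\frac{1+t}{1-t}$, $t=\frac{|z_1-z_2|}{|1-z_1\overline{z_2}|}$, and the hyperbolic area $dh(z)=\frac{4\,dm(z)}{(1-|z|^2)^2}$. With $\pi:\mathbb D\to\mathbb S$ the projection, put $\tilde h(p_1,p_2)=\inf\{h(z_1,z_2):\pi(z_i)=p_i\}$ and define the area of $E\subset\mathbb S$ by $\tilde h(E)=h(\pi^{-1}(E)\cap D_0)$, where $D_0$ is a fundamental (Dirichlet) polygon of $G$; lengths of curves in $\mathbb S$ are taken with respect to the metric $\tilde h$. The metric and area $\tilde h_*$ of $\mathbb S_*$ are defined in the same way. A *curve* is a continuous map of a bounded (open, closed or half-open) nondegenerate interval into the surface; it is locally rectifiable if all its closed subcurves have finite length. A Borel function $\rho:\mathbb S\to[0,\infty]$ is *admissible* for a family of curves $\Gamma$, $\rho\in\operatorname{adm}\Gamma$,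 if $\int_\gamma\rho\,ds_{\tilde h}\ge1$ for every locally rectifiable $\gamma\in\Gamma$; the *modulus* is $M(\Gamma)=\inf_{\rho\in\operatorname{adm}\Gamma}\int_{\mathbb S}\rho^2\,d\tilde h\in[0,\infty]$ (so curves that are not locally rectifiable do not influence it). A property holds for almost all curves in a set if the family of the curves in this set that fail it has modulus $0$. The same definitions are used on $\mathbb S_*$. For a locally rectifiable curve $\gamma$ on an interval $\Delta$ and a base point $t_0\in\Delta$, let $l_\gamma:\Delta\to\Delta_\gamma\subset\mathbb R$ be the length function: $l_\gamma(t)$ is the length of $\gamma|_{[t_0,t]}$ if $t\ge t_0$, and minus the length of $\gamma|_{[t,t_0]}$ if $t<t_0$. Let $D\subset\mathbb S$ and $f:D\to\mathbb S_*$ be continuous. The map $f$ is of class $ACP^{-1}$ in $D$ if $f$ maps no nonconstant curve of $D$ to a point and, for almost all curves $\tilde\gamma$ in $f(D)$, every lifting $\gamma$ of $\tilde\gamma$ (a curve $\gamma$ in $D$ with $f\circ\gamma=\tilde\gamma$) is locally rectifiable and the function $L_{\gamma,f}^{-1}:\Delta_{\tilde\gamma}\to\Delta_\gamma$, $L^{-1}_{\gamma,f}(l_{\tilde\gamma}(t))=l_\gamma(t)$,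 is absolutely continuous on every closed segment contained in $\Delta_{\tilde\gamma}$. For $D\subset\mathbb S$, $D_*\subset\mathbb S_*$, a map $f:D\to D_*$ has the Lusin $N$-property if $\tilde h_*(f(E))=0$ for each $E\subset D$ with $\tilde h(E)=0$, and the Lusin $N^{-1}$-property if $\tilde h(f^{-1}(E_*))=0$ for each $E_*\subset D_*$ with $\tilde h_*(E_*)=0$. At a point where $f$ is (real) differentiable in local coordinates, its dilatation is $$K_f=\frac{|f_z|+|f_{\bar z}|}{\bigl||f_z|-|f_{\bar z}|\bigr|}\quad\text{if } |f_z|\ne|f_{\bar z}|,$$ $K_f=1$ if $f_z=f_{\bar z}=0$, and $K_f=\infty$ otherwise; also $K_f=\infty$ where $f$ is not differentiable. This does not depend on the local coordinates. **Theorem.** Let $D\subset\mathbb S$ and $D_*\subset\mathbb S_*$ be domains with compact closures $\overline D$, $\overline{D_*}$. Let $f$ be a continuous map of $D$ onto $D_*$ that is differentiable almost everywhere (in local coordinates), belongs to the class $ACP^{-1}$ in $D$, and has the Lusin $N$- and $N^{-1}$-properties. Then for every family $\Gamma$ of curves in $D$ (in particular, of locally rectifiable curves) and every $\rho\in\operatorname{adm}\Gamma$,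 $$M(f(\Gamma))\le\int_D K_f(p)\,\rho^2(p)\,d\tilde h(p),$$ where $f(\Gamma)=\{f\circ\gamma:\gamma\in\Gamma\}$. -/

import Mathlib

open Set Filter Topology MeasureTheory
open scoped ENNReal ComplexConjugate Complex.UnitDisc

noncomputable section

namespace HypModulus

/-! ### The hyperbolic disc -/

/-- The hyperbolic distance `log ((1 + t) / (1 - t))`, `t = |z - w| / |1 - z * conj w|`,
of the unit disc. -/
def hypDist (z w : 𝔻) : ℝ :=
  let t : ℝ := ‖(z : ℂ) - w‖ / ‖1 - (z : ℂ) * conj (w : ℂ)‖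
  Real.log ((1 + t) / (1 - t))

/-- The unit disc carries its Borel sigma-algebra. -/
instance instMeasurableSpaceUnitDisc : MeasurableSpace 𝔻 := borel 𝔻

instance instBorelSpaceUnitDisc : BorelSpace 𝔻 := ⟨rfl⟩

/-- The hyperbolic area `4 dm(z) / (1 - |z|²)²` of the unit disc. -/
def hypArea : Measure 𝔻 :=
  ((volume : Measure ℂ).withDensity
    (fun z => ENNReal.ofReal (4 / (1 - ‖z‖ ^ 2) ^ 2))).comap (fun z : 𝔻 => (z : ℂ))

/-- Fractional linear automorphisms of the unit disc onto itself. -/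
def IsDiscMobius (g : Equiv.Perm 𝔻) : Prop :=
  ∃ (u : Circle) (a : 𝔻), ∀ z : 𝔻,
    (g z : ℂ) = (u : ℂ) * (((z : ℂ) - a) / (1 - conj (a : ℂ) * z))

/-- `G` is a group of fractional linear automorphisms of the unit disc which has no fixed points
in the disc and acts discontinuously there. -/
structure IsSurfaceGroup (G : Subgroup (Equiv.Perm 𝔻)) : Prop where
  mobius : ∀ g ∈ G, IsDiscMobius g
  fixedPointFree : ∀ g ∈ G, g ≠ 1 → ∀ z : 𝔻, g z ≠ z
  discontinuous : ∀ K : Set 𝔻, IsCompact K →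
    {g : Equiv.Perm 𝔻 | g ∈ G ∧ (g '' K ∩ K).Nonempty}.Finite

/-! ### The Riemann surface `𝔻 / G` -/

/-- The surface `𝔻 / G`: its points are the orbits of `G` in the unit disc. -/
def Surface (G : Subgroup (Equiv.Perm 𝔻)) : Type := MulAction.orbitRel.Quotient G 𝔻

/-- The natural projection `𝔻 → 𝔻 / G`. -/
def proj (G : Subgroup (Equiv.Perm 𝔻)) (z : 𝔻) : Surface G :=
  Quotient.mk (MulAction.orbitRel G 𝔻) z

/-- `𝔻 / G` carries the quotient topology. -/
instance instTopologicalSpaceSurface (G : Subgroup (Equiv.Perm 𝔻)) :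
    TopologicalSpace (Surface G) :=
  TopologicalSpace.coinduced (proj G) inferInstance

/-- `𝔻 / G` carries its Borel sigma-algebra. -/
instance instMeasurableSpaceSurface (G : Subgroup (Equiv.Perm 𝔻)) :
    MeasurableSpace (Surface G) := borel (Surface G)

instance instBorelSpaceSurface (G : Subgroup (Equiv.Perm 𝔻)) : BorelSpace (Surface G) := ⟨rfl⟩

/-- The metric of `𝔻 / G`: the infimum of the hyperbolic distances between the points of the two
orbits. -/
def surfDist {G : Subgroup (Equiv.Perm 𝔻)} (p q : Surface G) : ℝ :=
  sInf {r : ℝ | ∃ z w : 𝔻, proj G z = p ∧ proj G w = q ∧ hypDist z w = r}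

/-- The Dirichlet polygon of `G` with centre `0`. It is a fundamental domain: it meets every orbit
in at most one point, its closure meets every orbit, and its boundary has area zero. -/
def dirichlet (G : Subgroup (Equiv.Perm 𝔻)) : Set 𝔻 :=
  {z | ∀ g ∈ G, g ≠ 1 → hypDist z 0 < hypDist z (g 0)}

/-- The area of `𝔻 / G`: the hyperbolic area of the preimage of a set under the projection
restricted to a fundamental domain. -/
def area (G : Subgroup (Equiv.Perm 𝔻)) : Measure (Surface G) :=
  (hypArea.restrict (dirichlet G)).map (proj G)

/-! ### Curves and moduli -/

/-- A curve in `X`: a continuous map into `X` of a bounded interval `dom` of the real line (open,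
closed or half-open, not reduced to a point). The values of `toFun` outside `dom` play no role. -/
structure Curve (X : Type*) [TopologicalSpace X] where
  dom : Set ℝ
  ordConnected : dom.OrdConnected
  bounded : Bornology.IsBounded dom
  nontrivial : dom.Nontrivial
  toFun : ℝ → X
  continuousOn : ContinuousOn toFun dom

/-- The curve `γ` runs in the set `D`. -/
def Curve.In {X : Type*} [TopologicalSpace X] (γ : Curve X) (D : Set X) : Prop :=
  ∀ t ∈ γ.dom, γ.toFun t ∈ D

/-- The curve `γ'` is the composition `f ∘ γ`; that is, `γ` is a (total) lifting of `γ'`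
under `f`. -/
def IsImageCurve {X Y : Type*} [TopologicalSpace X] [TopologicalSpace Y] (f : X → Y)
    (γ : Curve X) (γ' : Curve Y) : Prop :=
  γ'.dom = γ.dom ∧ ∀ t ∈ γ.dom, γ'.toFun t = f (γ.toFun t)

/-- The family `f(Γ)` of all curves `f ∘ γ`, `γ ∈ Γ`. -/
def imageFamily {X Y : Type*} [TopologicalSpace X] [TopologicalSpace Y] (f : X → Y)
    (Γ : Set (Curve X)) : Set (Curve Y) :=
  {γ' | ∃ γ ∈ Γ, IsImageCurve f γ γ'}

section Length

variable {G : Subgroup (Equiv.Perm 𝔻)}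

/-- The length of the subcurve of `γ` over `[s, t]`: the supremum over all partitions
`u 0 ≤ u 1 ≤ … ≤ u n` of the sums of the distances between consecutive points. -/
def Curve.length (γ : Curve (Surface G)) (s t : ℝ) : ℝ≥0∞ :=
  ⨆ p : ℕ × {u : ℕ → ℝ // Monotone u ∧ ∀ i, u i ∈ Icc s t},
    ∑ i ∈ Finset.range p.1,
      ENNReal.ofReal (surfDist (γ.toFun (p.2.1 i)) (γ.toFun (p.2.1 (i + 1))))

/-- All closed subcurves have finite length. -/
def Curve.LocallyRectifiable (γ : Curve (Surface G)) : Prop :=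
  ∀ s ∈ γ.dom, ∀ t ∈ γ.dom, s ≤ t → γ.length s t < ∞

/-- The length function `l_γ` of a locally rectifiable curve, with `l_γ(t₀) = 0`. -/
def Curve.lengthFun (γ : Curve (Surface G)) (t₀ t : ℝ) : ℝ :=
  if t₀ ≤ t then (γ.length t₀ t).toReal else -(γ.length t t₀).toReal

/-- The normal representation of the subcurve of `γ` over `[s, t]`: at `r ∈ [0, l]` its value is
the point of that subcurve at distance `r` from its beginning, measured along the curve. -/
def Curve.normalRep (γ : Curve (Surface G)) (s t r : ℝ) : Surface G :=
  γ.toFun (Function.invFunOn (fun u => γ.lengthFun s u) (Icc s t) r)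

/-- The integral of `ρ` along a locally rectifiable curve with respect to arc length. For a closed
curve this is the integral of `ρ` along the normal representation, otherwise the supremum of these
integrals over all closed subcurves (for a closed curve the supremum is attained at the curve
itself). -/
def Curve.integral (γ : Curve (Surface G)) (ρ : Surface G → ℝ≥0∞) : ℝ≥0∞ :=
  ⨆ (s ∈ γ.dom) (t ∈ γ.dom) (_ : s ≤ t),
    ∫⁻ r in Icc 0 (γ.length s t).toReal, ρ (γ.normalRep s t r)

/-- The Borel functions `ρ ≥ 0` admissible for the family `Γ`: the integral of `ρ` is at
least `1` along each locally rectifiable curve of `Γ`. -/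
def adm (Γ : Set (Curve (Surface G))) : Set (Surface G → ℝ≥0∞) :=
  {ρ | Measurable ρ ∧ ∀ γ ∈ Γ, γ.LocallyRectifiable → 1 ≤ γ.integral ρ}

/-- The modulus of a family of curves. -/
def modulus (Γ : Set (Curve (Surface G))) : ℝ≥0∞ :=
  ⨅ ρ ∈ adm Γ, ∫⁻ p, ρ p ^ 2 ∂(area G)

/-- The property `P` holds for almost all curves in `E`. -/
def AlmostAllCurves (E : Set (Surface G)) (P : Curve (Surface G) → Prop) : Prop :=
  modulus {γ : Curve (Surface G) | γ.In E ∧ ¬ P γ} = 0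

end Length

/-! ### Maps between surfaces -/

section Maps

variable {G G' : Subgroup (Equiv.Perm 𝔻)}

/-- For `γ' = f ∘ γ`: the inverse `L⁻¹ : l_γ'(t) ↦ l_γ(t)` of the function `L_{γ,f}` is absolutely
continuous on all segments that lie in its domain `Δ_γ' = l_γ'(dom)`. Here `t₀` is the common base
point of the two length functions; the condition does not depend on it. -/
def InverseLengthAC (γ : Curve (Surface G)) (γ' : Curve (Surface G')) : Prop :=
  ∀ t₀ ∈ γ.dom, ∃ Linv : ℝ → ℝ,
    (∀ t ∈ γ.dom, Linv (γ'.lengthFun t₀ t) = γ.lengthFun t₀ t) ∧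
    ∀ c d : ℝ, c ≤ d → Icc c d ⊆ (fun t => γ'.lengthFun t₀ t) '' γ.dom →
      AbsolutelyContinuousOnInterval Linv c d

/-- The class `ACP⁻¹` in `D`: `f` maps no nonconstant curve of `D` to a point, and for almost all
curves `γ'` in `f(D)` every lifting `γ` of `γ'` in `D` is locally rectifiable, with `L_{γ,f}⁻¹`
absolutely continuous on all segments of its domain. -/
def ACPInv (f : Surface G → Surface G') (D : Set (Surface G)) : Prop :=
  (∀ α : Curve (Surface G), α.In D →
    (∀ s ∈ α.dom, ∀ t ∈ α.dom, f (α.toFun s) = f (α.toFun t)) →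
      ∀ s ∈ α.dom, ∀ t ∈ α.dom, α.toFun s = α.toFun t) ∧
  AlmostAllCurves (f '' D) fun γ' =>
    ∀ γ : Curve (Surface G), γ.In D → IsImageCurve f γ γ' →
      γ.LocallyRectifiable ∧ InverseLengthAC γ γ'

/-- The Lusin `N`-property of `f : D → D'`. -/
def LusinN (f : Surface G → Surface G') (D : Set (Surface G)) : Prop :=
  ∀ E ⊆ D, area G E = 0 → area G' (f '' E) = 0

/-- The Lusin `N⁻¹`-property of `f : D → D'`. -/
def LusinNInv (f : Surface G → Surface G') (D : Set (Surface G)) (D' : Set (Surface G')) : Prop :=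
  ∀ E' ⊆ D', area G' E' = 0 → area G (D ∩ f ⁻¹' E') = 0

/-- `A` is the (real Fréchet) derivative of `f` at `p` in some local coordinates. The local
coordinates of `𝔻 / G` are the local inverses of the projection, so the coordinate expression
of `f` near `p` is a local lifting `F` of `f` to the disc near a point `z` over `p`. -/
def HasLocalDeriv (f : Surface G → Surface G') (p : Surface G) (A : ℂ →L[ℝ] ℂ) : Prop :=
  ∃ (z : 𝔻) (F : ℂ → ℂ), proj G z = p ∧
    (∀ᶠ ζ : 𝔻 in 𝓝 z, ∃ w : 𝔻, (w : ℂ) = F ζ ∧ proj G' w = f (proj G ζ)) ∧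
    HasFDerivAt F A z

/-- `f_z = (f_x - i f_y) / 2` for the real linear map `A`. -/
def dz (A : ℂ →L[ℝ] ℂ) : ℂ := (A 1 - Complex.I * A Complex.I) / 2

/-- `f_z̄ = (f_x + i f_y) / 2` for the real linear map `A`. -/
def dzbar (A : ℂ →L[ℝ] ℂ) : ℂ := (A 1 + Complex.I * A Complex.I) / 2

open Classical in
/-- The dilatation of a real linear map: `(|f_z| + |f_z̄|) / ||f_z| - |f_z̄||` if the Jacobian
`|f_z|² - |f_z̄|²` is not zero, `1` if `|f_z| + |f_z̄| = 0`, and `∞` otherwise. -/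
def linDilatation (A : ℂ →L[ℝ] ℂ) : ℝ≥0∞ :=
  if ‖dz A‖ ^ 2 - ‖dzbar A‖ ^ 2 ≠ 0 then
    ENNReal.ofReal ((‖dz A‖ + ‖dzbar A‖) / |‖dz A‖ - ‖dzbar A‖|)
  else if ‖dz A‖ + ‖dzbar A‖ = 0 then 1
  else ∞

/-- The dilatation `K_f(p)`. All local coordinates at `p` give the same value of `linDilatation`,
so the infimum is this common value; it is `∞` where `f` is not differentiable. -/
def dilatation (f : Surface G → Surface G') (p : Surface G) : ℝ≥0∞ :=
  ⨅ (A : ℂ →L[ℝ] ℂ) (_ : HasLocalDeriv f p A), linDilatation A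

/-- `f` is differentiable (in local coordinates) at almost every point of `D`. -/
def AEDifferentiable (f : Surface G → Surface G') (D : Set (Surface G)) : Prop :=
  ∀ᵐ p ∂(area G), p ∈ D → ∃ A : ℂ →L[ℝ] ℂ, HasLocalDeriv f p A

end Maps

end HypModulus

end

/-! The proof builds a test function `R` for `f(Γ)` on the target. Let ℓ(p) be the smallest
hyperbolic stretching of `f` at a point p where the derivative is invertible. At q, `R` is the
supremum of ρ(p)/ℓ(p) over the preimages p of q that are regular, that is, have an invertible
derivative and lie together with q in the projected Dirichlet polygons. On a null set `E` containing
the images of all other points, `R` is infinite.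

`E` can be taken null for three reasons. Points not lying over the polygons are negligible, by the
definition of area and the N⁻¹-property. Points of nondifferentiability are null by assumption. The
critical points have a null image by Sard, hence are null by N⁻¹. The N-property then sends this
null set to a null set.

The area estimate (`exists_pushforward`, `exists_testFunction`) cuts the regular set into countably
many pieces on which the coordinate expression is injective. The Jacobian divided by the square of
the smallest stretching is the dilatation, so a change of variables bounds the integral of the
square of ρ/ℓ, carried to the target, by that of K_f ρ² over the piece. The square of a supremum is
at most the sum of the squares, so the pieces add up to an integral over at most `D`.

The line estimate (`lintegral_arcLength_le_of_lift`) concerns a curve γ' = f ∘ γ for which the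
length of γ is an absolutely continuous function v of the length of γ'. Unless the integral of `R`
along γ' is infinite, γ' spends no length in `E`. At almost every parameter `f` therefore expands by
almost ℓ, which forces v' ≤ 1/ℓ (`ae_deriv_le_of_le_eVariationOn`). Substituting v gives ∫_γ ρ ≤
∫_γ' R.

The curves for which v is not available form a family of modulus zero. They are absorbed by
replacing `R` with its maximum with an admissible function η of arbitrarily small energy. -/

namespace HypModulus

/-! ### Length functions of curves in metric spaces -/

section Variation

variable {X : Type*} [PseudoMetricSpace X]

/-- The length of the curve `α` over `[s, u]`. -/
noncomputable def arcLength (α : ℝ → X) (s u : ℝ) : ℝ := (eVariationOn α (Icc s u)).toReal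

variable {α : ℝ → X} {s t : ℝ}

theorem arcLength_self (α : ℝ → X) (s : ℝ) : arcLength α s s = 0 := by
  simp [arcLength, eVariationOn.subsingleton]

theorem arcLength_add (hα : eVariationOn α (Icc s t) ≠ ∞) {u w : ℝ} (hu : s ≤ u) (huw : u ≤ w)
    (hw : w ≤ t) : arcLength α s u + arcLength α u w = arcLength α s w := by
  have h := eVariationOn.Icc_add_Icc α (s := univ) hu huw (mem_univ u)
  simp only [univ_inter] at h
  rw [arcLength, arcLength, arcLength, ← h, ENNReal.toReal_add]
  · exact ne_top_of_le_ne_top hα (eVariationOn.mono α (Icc_subset_Icc le_rfl (huw.trans hw)))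
  · exact ne_top_of_le_ne_top hα (eVariationOn.mono α (Icc_subset_Icc hu hw))

theorem arcLength_nonneg (α : ℝ → X) (s u : ℝ) : 0 ≤ arcLength α s u := ENNReal.toReal_nonneg

theorem arcLength_monotoneOn (hα : eVariationOn α (Icc s t) ≠ ∞) :
    MonotoneOn (arcLength α s) (Icc s t) := fun u hu w hw huw => by
  rw [← arcLength_add hα hu.1 huw hw.2]
  exact le_add_of_nonneg_right (arcLength_nonneg α u w)

theorem dist_le_arcLength_sub (hα : eVariationOn α (Icc s t) ≠ ∞) {u w : ℝ} (hu : s ≤ u)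
    (huw : u ≤ w) (hw : w ≤ t) : dist (α u) (α w) ≤ arcLength α s w - arcLength α s u := by
  rw [← arcLength_add hα hu huw hw, add_sub_cancel_left, arcLength]
  exact BoundedVariationOn.dist_le
    (ne_top_of_le_ne_top hα (eVariationOn.mono α (Icc_subset_Icc hu hw)))
    (left_mem_Icc.2 huw) (right_mem_Icc.2 huw)

theorem dist_le_abs_arcLength_sub (hα : eVariationOn α (Icc s t) ≠ ∞) {u w : ℝ}
    (hu : u ∈ Icc s t) (hw : w ∈ Icc s t) :
    dist (α u) (α w) ≤ |arcLength α s u - arcLength α s w| := by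
  rcases le_total u w with h | h
  · rw [abs_sub_comm]
    exact (dist_le_arcLength_sub hα hu.1 h hw.2).trans (le_abs_self _)
  · rw [dist_comm]
    exact (dist_le_arcLength_sub hα hw.1 h hu.2).trans (le_abs_self _)

/-- The variation of a continuous curve of finite length over an interval shrinking to an endpoint
tends to zero; additivity turns this into continuity of the length. -/
theorem arcLength_continuousOn (hα : eVariationOn α (Icc s t) ≠ ∞)
    (hc : ContinuousOn α (Icc s t)) : ContinuousOn (arcLength α s) (Icc s t) := by
  intro x hx
  have key : Tendsto (fun y => (eVariationOn α (Icc s t ∩ Icc x y)).toReal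
      + (eVariationOn α (Icc s t ∩ Icc y x)).toReal) (𝓝[Icc s t] x) (𝓝 0) := by
    have h1 := BoundedVariationOn.tendsto_eVariationOn_Icc_zero_right hα x
      ((hc x hx).mono inter_subset_left)
    have h2 := BoundedVariationOn.tendsto_eVariationOn_Icc_zero_left hα
      ((hc x hx).mono inter_subset_left)
    simpa using ((ENNReal.tendsto_toReal ENNReal.zero_ne_top).comp h1).add
      ((ENNReal.tendsto_toReal ENNReal.zero_ne_top).comp h2)
  rw [ContinuousWithinAt, tendsto_iff_dist_tendsto_zero]
  refine squeeze_zero' (Eventually.of_forall fun _ => dist_nonneg) ?_ key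
  filter_upwards [self_mem_nhdsWithin] with y hy
  rcases le_total x y with h | h
  · have e : Icc s t ∩ Icc x y = Icc x y := by
      rw [inter_eq_right]; exact Icc_subset_Icc hx.1 hy.2
    rw [e, Real.dist_eq, ← arcLength_add hα hx.1 h hy.2, add_sub_cancel_left,
      abs_of_nonneg (arcLength_nonneg _ _ _)]
    exact le_add_of_nonneg_right ENNReal.toReal_nonneg
  · have e : Icc s t ∩ Icc y x = Icc y x := by
      rw [inter_eq_right]; exact Icc_subset_Icc hy.1 hx.2
    rw [e, Real.dist_eq, ← arcLength_add hα hy.1 h hx.2, abs_sub_comm, add_sub_cancel_left,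
      abs_of_nonneg (arcLength_nonneg _ _ _)]
    exact le_add_of_nonneg_left ENNReal.toReal_nonneg

theorem arcLength_image_Icc (hst : s ≤ t) (hα : eVariationOn α (Icc s t) ≠ ∞)
    (hc : ContinuousOn α (Icc s t)) :
    arcLength α s '' Icc s t = Icc 0 (arcLength α s t) := by
  refine Subset.antisymm ?_ ?_
  · rintro _ ⟨u, hu, rfl⟩
    exact ⟨arcLength_nonneg _ _ _, arcLength_monotoneOn hα hu (right_mem_Icc.2 hst) hu.2⟩
  · have := intermediate_value_Icc hst (arcLength_continuousOn hα hc)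
    rwa [arcLength_self] at this

theorem AbsolutelyContinuousOnInterval.of_dist_le {Y Z : Type*} [PseudoMetricSpace Y]
    [PseudoMetricSpace Z] {φ : ℝ → Y} {v : ℝ → Z} {a b : ℝ}
    (hv : AbsolutelyContinuousOnInterval v a b)
    (h : ∀ r ∈ uIcc a b, ∀ r' ∈ uIcc a b, dist (φ r) (φ r') ≤ dist (v r) (v r')) :
    AbsolutelyContinuousOnInterval φ a b := by
  rw [absolutelyContinuousOnInterval_iff] at hv ⊢
  intro ε hε
  obtain ⟨δ, hδ, H⟩ := hv ε hε
  refine ⟨δ, hδ, fun E hE hd => lt_of_le_of_lt (Finset.sum_le_sum fun i hi => ?_) (H E hE hd)⟩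
  have := hE.1 i hi
  exact h _ this.1 _ this.2

/-- If the absolutely continuous function `v` controls the oscillation of `x` and its total
increment is at most the length of `x`, then the derivative of `v` is almost everywhere at most
any pointwise bound for the local dilatation of `x`. -/
theorem ae_deriv_le_of_le_eVariationOn {x : ℝ → X} {v : ℝ → ℝ} {L : ℝ} (hL : 0 ≤ L)
    (hv : AbsolutelyContinuousOnInterval v 0 L)
    (hxv : ∀ a ∈ Icc 0 L, ∀ b ∈ Icc 0 L, a ≤ b → dist (x a) (x b) ≤ v b - v a)
    (hlen : ENNReal.ofReal (v L - v 0) ≤ eVariationOn x (Icc 0 L)) {g : ℝ → ℝ≥0∞}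
    (hg : ∀ᵐ r, r ∈ Ioo 0 L → ∀ c : NNReal, g r < c →
      ∀ᶠ r' in 𝓝 r, dist (x r') (x r) ≤ c * |r' - r|) :
    ∀ᵐ r, r ∈ Ioo 0 L → ENNReal.ofReal (deriv v r) ≤ g r := by
  -- Truncating by v' gives ∫ G ≤ ∫ v' for free. The reverse inequality, from summing over
  -- partitions, forces v' = G almost everywhere, hence v' ≤ g.
  set G : ℝ → ℝ≥0∞ := fun r => min (ENNReal.ofReal (deriv v r)) (g r) with hG
  have hvm : MonotoneOn v (Icc 0 L) := fun a ha b hb hab =>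
    sub_nonneg.1 (dist_nonneg.trans (hxv a ha b hb hab))
  have hvdist : ∀ a ∈ Icc 0 L, ∀ b ∈ Icc 0 L, dist (x a) (x b) ≤ dist (v a) (v b) := by
    intro a ha b hb
    rcases le_total a b with h | h
    · rw [dist_comm (v a), Real.dist_eq]
      exact (hxv a ha b hb h).trans (le_abs_self _)
    · rw [dist_comm, Real.dist_eq]
      exact (hxv b hb a ha h).trans (le_abs_self _)
  have uL : uIcc 0 L = Icc 0 L := uIcc_of_le hL
  have hvd := hv.ae_differentiableAt
  have hnn : ∀ᵐ r, r ∈ Ioo 0 L → 0 ≤ deriv v r := by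
    filter_upwards with r hr
    rw [← derivWithin_of_mem_nhds (Icc_mem_nhds hr.1 hr.2)]
    exact hvm.derivWithin_nonneg
  -- The real function φ(r) = dist (x a) (x r) inherits absolute continuity from v, so it is the
  -- integral of its derivative, and |φ'| is bounded by both v' and g.
  have hstep : ∀ a ∈ Icc 0 L, ∀ b ∈ Icc 0 L, a ≤ b →
      edist (x a) (x b) ≤ ∫⁻ r in Ioc a b, G r := by
    intro a ha b hb hab
    have hsub : Icc a b ⊆ Icc 0 L := Icc_subset_Icc ha.1 hb.2
    set φ : ℝ → ℝ := fun r => dist (x a) (x r) with hφ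
    have hφd : ∀ r ∈ Icc 0 L, ∀ r' ∈ Icc 0 L, |φ r - φ r'| ≤ dist (x r) (x r') := by
      intro r _ r' _
      have := dist_dist_dist_le (x a) (x r) (x a) (x r')
      simpa [Real.dist_eq] using this
    have hac : AbsolutelyContinuousOnInterval φ a b := by
      refine AbsolutelyContinuousOnInterval.of_dist_le
        (hv.mono (by rw [uL, uIcc_of_le hab]; exact hsub)) fun r hr r' hr' => ?_
      rw [uIcc_of_le hab] at hr hr'
      exact (hφd r (hsub hr) r' (hsub hr')).trans (hvdist r (hsub hr) r' (hsub hr'))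
    have hint := hac.integral_deriv_eq_sub
    have hφa : φ a = 0 := dist_self _
    rw [hφa, sub_zero, intervalIntegral.integral_of_le hab] at hint
    have h1 : edist (x a) (x b) = ENNReal.ofReal (∫ r in Ioc a b, deriv φ r) := by
      rw [hint, edist_dist]
    rw [h1]
    refine (ENNReal.ofReal_le_ofReal (le_abs_self _)).trans ?_
    rw [← Real.norm_eq_abs, ofReal_norm]
    refine (enorm_integral_le_lintegral_enorm _).trans ?_
    rw [← restrict_Ioo_eq_restrict_Ioc]
    refine lintegral_mono_ae ?_
    rw [ae_restrict_iff' measurableSet_Ioo]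
    filter_upwards [hg, hvd, hac.ae_differentiableAt] with r hgr hvr hφr hr
    have hr0 : r ∈ Ioo 0 L := ⟨ha.1.trans_lt hr.1, hr.2.trans_le hb.2⟩
    have hn : Icc 0 L ∈ 𝓝 r := Icc_mem_nhds hr0.1 hr0.2
    have dφ : HasDerivAt φ (deriv φ r) r :=
      (hφr (by rw [uIcc_of_le hab]; exact ⟨hr.1.le, hr.2.le⟩)).hasDerivAt
    have dv : HasDerivAt v (deriv v r) r :=
      (hvr (by rw [uL]; exact ⟨hr0.1.le, hr0.2.le⟩)).hasDerivAt
    have bound : ∀ c : ℝ, 0 ≤ c → (∀ᶠ r' in 𝓝 r, dist (x r') (x r) ≤ c * |r' - r|) →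
        |deriv φ r| ≤ c := by
      intro c hc h
      have := HasFDerivAt.le_of_lip' dφ.hasFDerivAt hc (by
        filter_upwards [h, hn] with r' h' hr'
        exact (hφd r' hr' r ⟨hr0.1.le, hr0.2.le⟩).trans h')
      simpa using this
    rw [hG]
    refine le_min ?_ ?_
    · rw [← ofReal_norm]
      refine ENNReal.ofReal_le_ofReal (le_of_forall_pos_le_add fun ε hε => ?_)
      have hdn : 0 ≤ deriv v r := by
        rw [← derivWithin_of_mem_nhds hn]; exact hvm.derivWithin_nonneg
      refine bound _ (by positivity) ?_
      have := (hasDerivAt_iff_isLittleO.1 dv).def hε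
      filter_upwards [this, hn] with r' h' hr'
      refine (hvdist r' hr' r ⟨hr0.1.le, hr0.2.le⟩).trans ?_
      rw [Real.dist_eq]
      have e : v r' - v r = (v r' - v r - (r' - r) • deriv v r) + (r' - r) * deriv v r := by
        simp
      rw [e]
      refine (abs_add_le _ _).trans ?_
      rw [abs_mul, abs_of_nonneg hdn, add_mul, add_comm, mul_comm (deriv v r)]
      exact add_le_add le_rfl h'
    · refine ENNReal.le_of_forall_nnreal_lt fun c hc => ?_
      by_contra hcon
      push Not at hcon
      have := bound c c.2 (hgr hr0 c hcon)
      have h2 : ‖deriv φ r‖ₑ ≤ c := by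
        rw [← ofReal_norm, ← ENNReal.ofReal_coe_nnreal]
        exact ENNReal.ofReal_le_ofReal this
      exact absurd hc (not_lt.2 h2)
  have htot : ENNReal.ofReal (v L - v 0) ≤ ∫⁻ r in Ioc 0 L, G r := by
    refine hlen.trans (iSup_le fun p => ?_)
    obtain ⟨n, u, hu, hm⟩ := p
    have hs : ∀ k, (∑ i ∈ Finset.range k, edist (x (u (i + 1))) (x (u i))) ≤
        ∫⁻ r in Ioc (u 0) (u k), G r := by
      intro k
      induction k with
      | zero => simp
      | succ k ih =>
        rw [Finset.sum_range_succ, ← Ioc_union_Ioc_eq_Ioc (hu (Nat.zero_le k)) (hu k.le_succ),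
          lintegral_union measurableSet_Ioc (Ioc_disjoint_Ioc_of_le le_rfl), edist_comm]
        exact add_le_add ih (hstep _ (hm k) _ (hm _) (hu k.le_succ))
    exact (hs n).trans (lintegral_mono_set (Ioc_subset_Ioc (hm 0).1 (hm n).2))
  have hint : IntegrableOn (deriv v) (Ioc 0 L) :=
    (intervalIntegrable_iff_integrableOn_Ioc_of_le hL).1 hv.intervalIntegrable_deriv
  have hnn' : 0 ≤ᵐ[volume.restrict (Ioc 0 L)] deriv v := by
    rw [← restrict_Ioo_eq_restrict_Ioc, EventuallyLE, ae_restrict_iff' measurableSet_Ioo]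
    exact hnn
  have hvint : ∫⁻ r in Ioc 0 L, ENNReal.ofReal (deriv v r) = ENNReal.ofReal (v L - v 0) := by
    rw [← hv.integral_deriv_eq_sub, intervalIntegral.integral_of_le hL,
      ofReal_integral_eq_lintegral_ofReal hint hnn']
  -- No measurability is assumed of g, so G is replaced by a measurable minorant with the same
  -- integral; then k ≤ v' and ∫ v' ≤ ∫ k < ∞ give equality almost everywhere.
  obtain ⟨k, hkm, hkG, hki⟩ := exists_measurable_le_lintegral_eq (volume.restrict (Ioc 0 L)) G
  have hkv : k ≤ᵐ[volume.restrict (Ioc 0 L)] fun r => ENNReal.ofReal (deriv v r) :=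
    Eventually.of_forall fun r => (hkG r).trans (min_le_left _ _)
  have := ae_eq_of_ae_le_of_lintegral_le hkv (by
      rw [← hki]; exact ne_top_of_le_ne_top (hvint ▸ ENNReal.ofReal_ne_top)
        (lintegral_mono fun r => min_le_left _ _))
    (measurable_deriv v).ennreal_ofReal.aemeasurable (by rw [hvint, ← hki]; exact htot)
  rw [← restrict_Ioo_eq_restrict_Ioc, EventuallyEq, ae_restrict_iff' measurableSet_Ioo] at this
  filter_upwards [this] with r h hr
  rw [← h hr]
  exact (hkG r).trans (min_le_right _ _)

/-- Change of variables for absolutely continuous increasing functions. -/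
theorem lintegral_Icc_le_lintegral_deriv_mul {v : ℝ → ℝ} {L : ℝ} (hL : 0 ≤ L)
    (hv : AbsolutelyContinuousOnInterval v 0 L) (hm : MonotoneOn v (Icc 0 L)) (F : ℝ → ℝ≥0∞) :
    ∫⁻ y in Icc (v 0) (v L), F y ≤ ∫⁻ r in Ioo 0 L, ENNReal.ofReal (deriv v r) * F (v r) := by
  set S : Set ℝ := Ioo 0 L ∩ {r | DifferentiableAt ℝ v r} with hS
  have hSm : MeasurableSet S := measurableSet_Ioo.inter (measurableSet_of_differentiableAt ℝ v)
  have hSI : S ⊆ Icc 0 L := inter_subset_left.trans Ioo_subset_Icc_self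
  have hd : ∀ r ∈ S, HasDerivWithinAt v (deriv v r) S r := fun r hr =>
    hr.2.hasDerivAt.hasDerivWithinAt
  have cov := fun u => lintegral_image_eq_lintegral_deriv_mul_of_monotoneOn hSm hd
    (hm.mono hSI) u
  have hae : S =ᵐ[volume] Ioc 0 L := by
    refine EventuallyEq.trans ?_ (Ioo_ae_eq_Ioc (μ := volume) (a := (0 : ℝ)) (b := L))
    filter_upwards [hv.ae_differentiableAt] with r hr
    rw [eq_iff_iff]
    exact ⟨fun h => h.1, fun h => ⟨h, hr (by rw [uIcc_of_le hL]; exact ⟨h.1.le, h.2.le⟩)⟩⟩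
  have hint : IntegrableOn (deriv v) (Ioc 0 L) :=
    (intervalIntegrable_iff_integrableOn_Ioc_of_le hL).1 hv.intervalIntegrable_deriv
  have hnn' : 0 ≤ᵐ[volume.restrict (Ioc 0 L)] deriv v := by
    rw [← restrict_Ioo_eq_restrict_Ioc, EventuallyLE, ae_restrict_iff' measurableSet_Ioo]
    refine Eventually.of_forall fun r hr => ?_
    simp only [Pi.zero_apply]
    rw [← derivWithin_of_mem_nhds (Icc_mem_nhds hr.1 hr.2)]
    exact hm.derivWithin_nonneg
  have hvint : ∫⁻ r in Ioc 0 L, ENNReal.ofReal (deriv v r) = ENNReal.ofReal (v L - v 0) := by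
    rw [← hv.integral_deriv_eq_sub, intervalIntegral.integral_of_le hL,
      ofReal_integral_eq_lintegral_ofReal hint hnn']
  have hvol : volume (v '' S) = ENNReal.ofReal (v L - v 0) := by
    have := cov 1
    simpa [setLIntegral_congr hae, hvint] using this
  have hsub : v '' S ⊆ Icc (v 0) (v L) := by
    rintro _ ⟨r, hr, rfl⟩
    exact ⟨hm (left_mem_Icc.2 hL) (hSI hr) (hSI hr).1, hm (hSI hr) (right_mem_Icc.2 hL) (hSI hr).2⟩
  -- In the decomposition of `S`, the part a is countable, the image of b is countable, and v is
  -- injective on c, so each image is measurable.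
  have hmeas : MeasurableSet (v '' S) := by
    obtain ⟨a, b, c, hu, ha, hb, hc, -, -, hac, hbc, -, -, hci⟩ :=
      exists_decomposition_of_monotoneOn_hasDerivWithinAt hSm (hm.mono hSI) hd
    have hcS : c ⊆ S := fun r hr => hu ▸ Or.inr (Or.inr hr)
    rw [← hu, image_union, image_union]
    exact (hac.image v).measurableSet.union (hbc.measurableSet.union
      (hc.image_of_continuousOn_injOn (fun r hr => ((hd r (hcS hr)).continuousWithinAt.mono hcS))
        hci))
  -- Absolute continuity enters here: v(S) has measure ∫ v' = v(L) - v(0), so it fills the whole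
  -- interval up to a null set.
  have hI : v '' S =ᵐ[volume] Icc (v 0) (v L) := by
    refine ae_eq_of_subset_of_measure_ge hsub ?_ hmeas.nullMeasurableSet ?_
    · rw [hvol, Real.volume_Icc]
    · rw [Real.volume_Icc]; exact ENNReal.ofReal_ne_top
  rw [← setLIntegral_congr hI, cov]
  exact lintegral_mono_set inter_subset_left

end Variation

/-- Comparison of the line integral along `α` with the one along its image `β = f ∘ α`: if `f`
expands distances at `p = α u` by at least the factor `1 / ψ p` and `ψ p * ρ p ≤ R (f p)`, except
where `β` runs in a set on which `R` is infinite, and the length of `α` is an absolutely continuous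
function of the length of `β`, then the integral of `ρ` along `α` is at most that of `R`
along `β`. -/
theorem lintegral_arcLength_le_of_lift {X Y : Type*} [MetricSpace X] [MetricSpace Y]
    [MeasurableSpace Y] [BorelSpace Y] {α : ℝ → X} {β : ℝ → Y} {s t : ℝ} (hst : s ≤ t)
    (hαc : ContinuousOn α (Icc s t)) (hβc : ContinuousOn β (Icc s t))
    (hα : eVariationOn α (Icc s t) ≠ ∞) (hβ : eVariationOn β (Icc s t) ≠ ∞)
    {v : ℝ → ℝ} (hv : AbsolutelyContinuousOnInterval v 0 (arcLength β s t))
    (hvl : ∀ u ∈ Icc s t, v (arcLength β s u) = arcLength α s u)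
    {σα σβ : ℝ → ℝ}
    (hσα : ∀ r ∈ Icc 0 (arcLength α s t), σα r ∈ Icc s t ∧ arcLength α s (σα r) = r)
    (hσβ : ∀ r ∈ Icc 0 (arcLength β s t), σβ r ∈ Icc s t ∧ arcLength β s (σβ r) = r)
    {f : X → Y} {D : Set X} (hf : ∀ u ∈ Icc s t, β u = f (α u)) (hD : ∀ u ∈ Icc s t, α u ∈ D)
    {E : Set Y} {ψ ρ : X → ℝ≥0∞} {R : Y → ℝ≥0∞} (hRm : Measurable R) (hRE : ∀ q ∈ E, R q = ∞)
    (hloc : ∀ p ∈ D, f p ∉ E → ∀ c : NNReal, ψ p < c →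
      ∀ᶠ p' in 𝓝 p, p' ∈ D → dist p' p ≤ c * dist (f p') (f p))
    (hR : ∀ p ∈ D, f p ∉ E → ψ p * ρ p ≤ R (f p)) :
    ∫⁻ r in Icc 0 (arcLength α s t), ρ (α (σα r)) ≤
      ∫⁻ r in Icc 0 (arcLength β s t), R (β (σβ r)) := by
  set L := arcLength β s t with hLdef
  have hL : 0 ≤ L := arcLength_nonneg _ _ _
  have hlβ : ∀ u ∈ Icc s t, arcLength β s u ∈ Icc 0 L := fun u hu =>
    arcLength_image_Icc hst hβ hβc ▸ mem_image_of_mem _ hu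
  have hlα : ∀ u ∈ Icc s t, arcLength α s u ∈ Icc 0 (arcLength α s t) := fun u hu =>
    arcLength_image_Icc hst hα hαc ▸ mem_image_of_mem _ hu
  have hv0 : v 0 = 0 := by
    have := hvl s (left_mem_Icc.2 hst)
    rwa [arcLength_self, arcLength_self] at this
  have hvL : v L = arcLength α s t := hvl t (right_mem_Icc.2 hst)
  have hvσ : ∀ r ∈ Icc 0 L, v r = arcLength α s (σβ r) := fun r hr => by
    rw [← hvl _ (hσβ r hr).1, (hσβ r hr).2]
  have hσm : ∀ r ∈ Icc 0 L, ∀ r' ∈ Icc 0 L, r < r' → σβ r ≤ σβ r' := fun r hr r' hr' h => by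
    by_contra hcon
    have := arcLength_monotoneOn hβ (hσβ r' hr').1 (hσβ r hr).1 (not_le.1 hcon).le
    rw [(hσβ r hr).2, (hσβ r' hr').2] at this
    exact absurd h (not_lt.2 this)
  -- The curve is constant where its length function is, so the arbitrary choice of parameters made
  -- by σα and σβ does not affect the points reached.
  have hinj : ∀ u ∈ Icc s t, ∀ w ∈ Icc s t, arcLength α s u = arcLength α s w → α u = α w :=
    fun u hu w hw h => by
      have := dist_le_abs_arcLength_sub hα hu hw
      rw [h, sub_self, abs_zero] at this
      exact dist_le_zero.1 this
  set x : ℝ → X := fun r => α (σβ r) with hx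
  have hxv : ∀ a ∈ Icc 0 L, ∀ b ∈ Icc 0 L, a ≤ b → dist (x a) (x b) ≤ v b - v a := by
    intro a ha b hb hab
    rcases hab.eq_or_lt with rfl | hab
    · simp
    rw [hvσ a ha, hvσ b hb]
    exact dist_le_arcLength_sub hα (hσβ a ha).1.1 (hσm a ha b hb hab) (hσβ b hb).1.2
  have hvm : MonotoneOn v (Icc 0 L) := fun a ha b hb hab =>
    sub_nonneg.1 (dist_nonneg.trans (hxv a ha b hb hab))
  -- Reparametrising α by the length of β loses no length: α = x ∘ l_β, because both sides sit at
  -- the same α-length.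
  have hlen : ENNReal.ofReal (v L - v 0) ≤ eVariationOn x (Icc 0 L) := by
    have h1 : eVariationOn α (Icc s t) = eVariationOn (x ∘ arcLength β s) (Icc s t) := by
      refine eVariationOn.congr fun u hu => ?_
      refine hinj u hu _ (hσβ _ (hlβ u hu)).1 ?_
      rw [← hvσ _ (hlβ u hu), hvl u hu]
    rw [hvL, hv0, sub_zero, arcLength, ENNReal.ofReal_toReal hα, h1,
      eVariationOn.comp_eq_of_monotoneOn _ _ (arcLength_monotoneOn hβ),
      arcLength_image_Icc hst hβ hβc]
  set y : ℝ → Y := fun r => β (σβ r) with hy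
  have hyx : ∀ r ∈ Icc 0 L, y r = f (x r) := fun r hr => hf _ (hσβ r hr).1
  have hylip : ∀ r ∈ Icc 0 L, ∀ r' ∈ Icc 0 L, dist (y r) (y r') ≤ |r - r'| := by
    intro r hr r' hr'
    have := dist_le_abs_arcLength_sub hβ (hσβ r hr).1 (hσβ r' hr').1
    rwa [(hσβ r hr).2, (hσβ r' hr').2] at this
  have hyc : ContinuousOn y (Icc 0 L) := by
    refine (LipschitzOnWith.of_dist_le_mul (K := 1) fun r hr r' hr' => ?_).continuousOn
    simpa [Real.dist_eq] using hylip r hr r' hr'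
  by_cases htop : ∫⁻ r in Icc 0 L, R (y r) = ∞
  · exact htop ▸ le_top
  have hym : AEMeasurable (fun r => R (y r)) (volume.restrict (Icc 0 L)) :=
    hRm.comp_aemeasurable (hyc.aemeasurable measurableSet_Icc)
  -- A finite integral makes R finite at almost every parameter, whereas R is infinite on E.
  have hE : ∀ᵐ r, r ∈ Icc 0 L → y r ∉ E := by
    have := ae_lt_top' hym htop
    rw [ae_restrict_iff' measurableSet_Icc] at this
    filter_upwards [this] with r h hr hmem
    exact (h hr).ne (hRE _ hmem)
  have hvc : ContinuousOn v (Icc 0 L) := by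
    have := hv.continuousOn
    rwa [uIcc_of_le hL] at this
  -- β in its length parameter is 1-Lipschitz, so the local expansion of f at x r bounds the
  -- dilatation of x there by any c > ψ(x r).
  have hspeed : ∀ᵐ r, r ∈ Ioo 0 L → ENNReal.ofReal (deriv v r) ≤ ψ (x r) := by
    refine ae_deriv_le_of_le_eVariationOn hL hv hxv hlen ?_
    filter_upwards [hE] with r hrE hr c hc
    have hrI : r ∈ Icc 0 L := Ioo_subset_Icc_self hr
    have hn : Icc 0 L ∈ 𝓝 r := Icc_mem_nhds hr.1 hr.2
    have hxc : Tendsto x (𝓝 r) (𝓝 (x r)) := by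
      rw [tendsto_iff_dist_tendsto_zero]
      have hz : Tendsto (fun r' => |v r' - v r|) (𝓝 r) (𝓝 0) := by
        have := ((hvc.continuousAt hn).sub (continuousAt_const (y := v r))).abs
        simpa [ContinuousAt] using this
      refine squeeze_zero' (Eventually.of_forall fun _ => dist_nonneg) ?_ hz
      filter_upwards [hn] with r' hr'
      rw [hvσ r hrI, hvσ r' hr']
      exact dist_le_abs_arcLength_sub hα (hσβ r' hr').1 (hσβ r hrI).1
    have hnE : f (x r) ∉ E := hyx r hrI ▸ hrE hrI
    filter_upwards [hxc.eventually (hloc (x r) (hD _ (hσβ r hrI).1) hnE c hc), hn] with r' h hr'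
    refine (h (hD _ (hσβ r' hr').1)).trans ?_
    rw [← hyx r hrI, ← hyx r' hr']
    exact mul_le_mul_of_nonneg_left (hylip r' hr' r hrI) c.2
  have hcov := lintegral_Icc_le_lintegral_deriv_mul hL hv hvm fun r => ρ (α (σα r))
  rw [hv0, hvL] at hcov
  refine hcov.trans ((lintegral_mono_ae ?_).trans (lintegral_mono_set Ioo_subset_Icc_self))
  rw [ae_restrict_iff' measurableSet_Ioo]
  filter_upwards [hspeed, hE] with r h1 h2 hr
  have hrI : r ∈ Icc 0 L := Ioo_subset_Icc_self hr
  have hvr : v r ∈ Icc 0 (arcLength α s t) := hvσ r hrI ▸ hlα _ (hσβ r hrI).1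
  have e : α (σα (v r)) = x r :=
    hinj _ (hσα _ hvr).1 _ (hσβ r hrI).1 (by rw [(hσα _ hvr).2, hvσ r hrI])
  rw [e]
  refine (mul_le_mul_left (h1 hr) _).trans ?_
  have := hR (x r) (hD _ (hσβ r hrI).1) (hyx r hrI ▸ h2 hrI)
  rwa [← hyx r hrI] at this

/-! ### Hyperbolic geometry of the disc -/

/-- The pseudohyperbolic distance. -/
noncomputable def pseudoDist (z w : ℂ) : ℝ := ‖z - w‖ / ‖1 - z * conj w‖

theorem hypDist_eq (z w : 𝔻) :
    hypDist z w = Real.log ((1 + pseudoDist z w) / (1 - pseudoDist z w)) := rfl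

/-- This identity makes the denominator of the pseudohyperbolic distance nonzero and the distance
itself less than 1. -/
theorem norm_one_sub_mul_conj_sq (z w : ℂ) :
    ‖1 - z * conj w‖ ^ 2 = ‖z - w‖ ^ 2 + (1 - ‖z‖ ^ 2) * (1 - ‖w‖ ^ 2) := by
  simp only [Complex.sq_norm, Complex.normSq_apply, Complex.sub_re, Complex.sub_im, Complex.mul_re,
    Complex.mul_im, Complex.conj_re, Complex.conj_im, Complex.one_re, Complex.one_im]
  ring

theorem one_sub_norm_sq_pos {z : ℂ} (hz : ‖z‖ < 1) : 0 < 1 - ‖z‖ ^ 2 := by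
  nlinarith [norm_nonneg z]

theorem one_sub_mul_conj_ne_zero {z w : ℂ} (hz : ‖z‖ < 1) (hw : ‖w‖ < 1) :
    1 - z * conj w ≠ 0 := by
  intro h
  have := norm_one_sub_mul_conj_sq z w
  rw [h, norm_zero] at this
  nlinarith [mul_pos (one_sub_norm_sq_pos hz) (one_sub_norm_sq_pos hw), sq_nonneg ‖z - w‖]

theorem norm_one_sub_mul_conj_pos {z w : ℂ} (hz : ‖z‖ < 1) (hw : ‖w‖ < 1) :
    0 < ‖1 - z * conj w‖ := norm_pos_iff.2 (one_sub_mul_conj_ne_zero hz hw)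

theorem pseudoDist_nonneg (z w : ℂ) : 0 ≤ pseudoDist z w := by unfold pseudoDist; positivity

theorem one_sub_pseudoDist_sq {z w : ℂ} (hz : ‖z‖ < 1) (hw : ‖w‖ < 1) :
    1 - pseudoDist z w ^ 2 = (1 - ‖z‖ ^ 2) * (1 - ‖w‖ ^ 2) / ‖1 - z * conj w‖ ^ 2 := by
  have := norm_one_sub_mul_conj_pos hz hw
  rw [pseudoDist, div_pow, eq_div_iff (by positivity), sub_mul, div_mul_cancel₀ _ (by positivity),
    norm_one_sub_mul_conj_sq]
  ring

theorem pseudoDist_lt_one {z w : ℂ} (hz : ‖z‖ < 1) (hw : ‖w‖ < 1) : pseudoDist z w < 1 := by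
  have h := one_sub_pseudoDist_sq hz hw
  have : 0 < (1 - ‖z‖ ^ 2) * (1 - ‖w‖ ^ 2) / ‖1 - z * conj w‖ ^ 2 :=
    div_pos (mul_pos (one_sub_norm_sq_pos hz) (one_sub_norm_sq_pos hw))
      (pow_pos (norm_one_sub_mul_conj_pos hz hw) 2)
  nlinarith [pseudoDist_nonneg z w]

theorem pseudoDist_comm (z w : ℂ) : pseudoDist z w = pseudoDist w z := by
  rw [pseudoDist, pseudoDist, norm_sub_rev]
  congr 1
  rw [← Complex.norm_conj]
  simp [mul_comm]

/-- The fractional linear automorphism `z ↦ u (z - a) / (1 - conj a z)`. -/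
noncomputable def mobius (u a z : ℂ) : ℂ := u * ((z - a) / (1 - conj a * z))

theorem pseudoDist_mobius {u a z w : ℂ} (hu : ‖u‖ = 1) (ha : ‖a‖ < 1) (hz : ‖z‖ < 1)
    (hw : ‖w‖ < 1) : pseudoDist (mobius u a z) (mobius u a w) = pseudoDist z w := by
  have h1' : 1 - z * conj a ≠ 0 := one_sub_mul_conj_ne_zero hz ha
  have h2' : 1 - w * conj a ≠ 0 := one_sub_mul_conj_ne_zero hw ha
  have h1 : 1 - conj a * z ≠ 0 := by rwa [mul_comm]
  have h2 : 1 - conj a * w ≠ 0 := by rwa [mul_comm]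
  have h3 : 1 - a * conj w ≠ 0 := one_sub_mul_conj_ne_zero ha hw
  have h4 : 1 - z * conj w ≠ 0 := one_sub_mul_conj_ne_zero hz hw
  have huu : u * conj u = 1 := by
    rw [Complex.mul_conj, Complex.normSq_eq_norm_sq, hu]; simp
  have hk : (1 - a * conj a : ℂ) ≠ 0 := one_sub_mul_conj_ne_zero ha ha
  have e1 : mobius u a z - mobius u a w =
      u * ((z - w) * (1 - a * conj a)) / ((1 - conj a * z) * (1 - conj a * w)) := by
    unfold mobius; field_simp; ring
  have e2 : 1 - mobius u a z * conj (mobius u a w) =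
      (1 - z * conj w) * (1 - a * conj a) / ((1 - conj a * z) * (1 - a * conj w)) := by
    have : mobius u a z * conj (mobius u a w) =
        (u * conj u) * ((z - a) * (conj w - conj a) / ((1 - conj a * z) * (1 - a * conj w))) := by
      simp only [mobius, map_mul, map_div₀, map_sub, map_one, Complex.conj_conj]
      field_simp
    rw [this, huu]
    field_simp
    ring
  have e3 : ‖1 - a * conj w‖ = ‖1 - conj a * w‖ := by
    rw [← Complex.norm_conj]; simp
  have p1 := norm_pos_iff.2 h1'
  have p2 := norm_pos_iff.2 h2'
  have p4 := norm_pos_iff.2 h4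
  have pk := norm_pos_iff.2 hk
  rw [pseudoDist, pseudoDist, e1, e2]
  simp only [norm_div, norm_mul, hu, e3, one_mul, mul_comm (conj a)]
  field_simp

theorem pseudoDist_zero_right (z : ℂ) : pseudoDist z 0 = ‖z‖ := by simp [pseudoDist]

/-- Move a to 0 by an automorphism. With N = |1 - z conj w| for the moved points, 1 - τ² = (1 -
x²)(1 - y²)/N² and N ≤ 1 + xy, while (1 + xy)² - (1 - x²)(1 - y²) = (x + y)². This is the addition
law of tanh, and becomes the triangle inequality after taking log((1 + t)/(1 - t)). -/
theorem pseudoDist_triangle {z a w : ℂ} (hz : ‖z‖ < 1) (ha : ‖a‖ < 1) (hw : ‖w‖ < 1) :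
    pseudoDist z w * (1 + pseudoDist z a * pseudoDist a w) ≤ pseudoDist z a + pseudoDist a w := by
  set x := pseudoDist z a with hx
  set y := pseudoDist a w with hy
  have hm0 : mobius 1 a a = 0 := by simp [mobius]
  have hZ : ‖mobius 1 a z‖ = x := by
    rw [hx, ← pseudoDist_mobius (u := 1) (by simp) ha hz ha, hm0, pseudoDist_zero_right]
  have hW : ‖mobius 1 a w‖ = y := by
    rw [hy, pseudoDist_comm, ← pseudoDist_mobius (u := 1) (by simp) ha hw ha, hm0,
      pseudoDist_zero_right]
  have x0 : 0 ≤ x := pseudoDist_nonneg _ _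
  have y0 : 0 ≤ y := pseudoDist_nonneg _ _
  have x1 : x < 1 := pseudoDist_lt_one hz ha
  have y1 : y < 1 := pseudoDist_lt_one ha hw
  have key := one_sub_pseudoDist_sq (z := mobius 1 a z) (w := mobius 1 a w) (hZ ▸ x1) (hW ▸ y1)
  rw [pseudoDist_mobius (by simp) ha hz hw, hZ, hW] at key
  have hN : ‖1 - mobius 1 a z * conj (mobius 1 a w)‖ ≤ 1 + x * y := by
    refine (norm_sub_le _ _).trans ?_
    simp [hZ, hW]
  have hNp := norm_one_sub_mul_conj_pos (hZ ▸ x1) (hW ▸ y1)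
  set N := ‖1 - mobius 1 a z * conj (mobius 1 a w)‖
  rw [eq_div_iff (by positivity)] at key
  have t0 := pseudoDist_nonneg z w
  have t1 : pseudoDist z w < 1 := pseudoDist_lt_one hz hw
  set τ := pseudoDist z w
  have hτ : 0 ≤ 1 - τ ^ 2 := by nlinarith
  have h2 : N ^ 2 ≤ (1 + x * y) ^ 2 := pow_le_pow_left₀ hNp.le hN 2
  have h3 := mul_le_mul_of_nonneg_left h2 hτ
  refine (abs_le_of_sq_le_sq' ?_ (by positivity)).2
  nlinarith

theorem hypDist_comm (z w : 𝔻) : hypDist z w = hypDist w z := by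
  rw [hypDist_eq, hypDist_eq, pseudoDist_comm]

theorem hypDist_triangle (z a w : 𝔻) : hypDist z w ≤ hypDist z a + hypDist a w := by
  have h := pseudoDist_triangle z.norm_lt_one a.norm_lt_one w.norm_lt_one
  simp only [hypDist_eq]
  have x0 := pseudoDist_nonneg z a
  have y0 := pseudoDist_nonneg a w
  have x1 := pseudoDist_lt_one z.norm_lt_one a.norm_lt_one
  have y1 := pseudoDist_lt_one a.norm_lt_one w.norm_lt_one
  have t0 := pseudoDist_nonneg z w
  have t1 := pseudoDist_lt_one z.norm_lt_one w.norm_lt_one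
  set x := pseudoDist z a
  set y := pseudoDist a w
  set τ := pseudoDist z w
  rw [← Real.log_mul (div_pos (by linarith) (by linarith)).ne'
    (div_pos (by linarith) (by linarith)).ne']
  refine Real.log_le_log (div_pos (by linarith) (by linarith)) ?_
  rw [div_mul_div_comm, div_le_div_iff₀ (by linarith)
    (mul_pos (by linarith) (by linarith))]
  nlinarith

theorem hypDist_self (z : 𝔻) : hypDist z z = 0 := by simp [hypDist]

/-- The denominator is at most 2, and t ≤ log((1 + t)/(1 - t)). Nonnegativity, definiteness and the
comparison of topologies all come from this bound. -/
theorem norm_sub_le_hypDist (z w : 𝔻) : ‖(z : ℂ) - w‖ ≤ 2 * hypDist z w := by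
  have t0 := pseudoDist_nonneg z w
  have t1 := pseudoDist_lt_one z.norm_lt_one w.norm_lt_one
  have hN : ‖1 - (z : ℂ) * conj (w : ℂ)‖ ≤ 2 := by
    refine (norm_sub_le _ _).trans ?_
    have := mul_le_one₀ z.norm_lt_one.le (norm_nonneg _) w.norm_lt_one.le
    simp only [norm_one, norm_mul, Complex.norm_conj]
    linarith
  have h1 : ‖(z : ℂ) - w‖ ≤ 2 * pseudoDist z w := by
    have hp := norm_one_sub_mul_conj_pos z.norm_lt_one w.norm_lt_one
    have : ‖(z : ℂ) - w‖ = pseudoDist z w * ‖1 - (z : ℂ) * conj (w : ℂ)‖ := by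
      rw [pseudoDist, div_mul_cancel₀ _ hp.ne']
    rw [this, mul_comm 2]
    exact mul_le_mul_of_nonneg_left hN t0
  refine h1.trans (mul_le_mul_of_nonneg_left ?_ zero_le_two)
  rw [hypDist_eq, Real.log_div (by linarith) (by linarith)]
  have h2 := Real.log_le_sub_one_of_pos (x := 1 - pseudoDist z w) (by linarith)
  have h3 := Real.log_nonneg (x := 1 + pseudoDist z w) (by linarith)
  linarith

theorem hypDist_nonneg (z w : 𝔻) : 0 ≤ hypDist z w := by
  linarith [norm_sub_le_hypDist z w, norm_nonneg ((z : ℂ) - w)]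

theorem eq_of_hypDist_eq_zero {z w : 𝔻} (h : hypDist z w = 0) : z = w := by
  have := norm_sub_le_hypDist z w
  rw [h, mul_zero, norm_le_zero_iff, sub_eq_zero] at this
  exact Complex.UnitDisc.coe_injective this

theorem continuous_hypDist : Continuous fun p : 𝔻 × 𝔻 => hypDist p.1 p.2 := by
  have c1 : Continuous fun p : 𝔻 × 𝔻 => (p.1 : ℂ) :=
    Complex.UnitDisc.continuous_coe.comp continuous_fst
  have c2 : Continuous fun p : 𝔻 × 𝔻 => (p.2 : ℂ) :=
    Complex.UnitDisc.continuous_coe.comp continuous_snd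
  have ct : Continuous fun p : 𝔻 × 𝔻 => pseudoDist p.1 p.2 := by
    unfold pseudoDist
    exact (c1.sub c2).norm.div
      ((continuous_const.sub (c1.mul (Complex.continuous_conj.comp c2))).norm)
      fun p => (norm_one_sub_mul_conj_pos p.1.norm_lt_one p.2.norm_lt_one).ne'
  simp only [hypDist_eq]
  have ht : ∀ p : 𝔻 × 𝔻, 0 < 1 - pseudoDist p.1 p.2 := fun p =>
    sub_pos.2 (pseudoDist_lt_one p.1.norm_lt_one p.2.norm_lt_one)
  refine Continuous.log ((continuous_const.add ct).div (continuous_const.sub ct)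
    fun p => (ht p).ne') fun p => ?_
  exact (div_pos (by linarith [pseudoDist_nonneg p.1 p.2]) (ht p)).ne'

theorem continuous_hypDist_right (z : 𝔻) : Continuous fun w => hypDist z w :=
  continuous_hypDist.comp (Continuous.prodMk continuous_const continuous_id)

/-- The hyperbolic balls form a basis of neighbourhoods. -/
theorem nhds_basis_hypDist (z : 𝔻) :
    (𝓝 z).HasBasis (fun ε : ℝ => 0 < ε) fun ε => {w | hypDist z w < ε} := by
  refine ⟨fun s => ⟨fun hs => ?_, fun ⟨ε, hε, hs⟩ => ?_⟩⟩
  · rw [Complex.UnitDisc.isEmbedding_coe.nhds_eq_comap, mem_comap] at hs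
    obtain ⟨u, hu, hus⟩ := hs
    obtain ⟨δ, hδ, hb⟩ := Metric.mem_nhds_iff.1 hu
    refine ⟨δ / 2, by positivity, fun w hw => hus (hb ?_)⟩
    rw [mem_ball_iff_norm, norm_sub_rev]
    have := norm_sub_le_hypDist z w
    have hw' : hypDist z w < δ / 2 := hw
    linarith
  · refine mem_of_superset ?_ hs
    refine (continuous_hypDist_right z).continuousAt.eventually_lt continuousAt_const ?_
    rwa [hypDist_self]

/-- The ball lies in a hyperbolic ball about 0, which is the Euclidean disc of radius tanh(C'/2) <
1. This properness is what makes discontinuity of the group usable metrically. -/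
theorem isCompact_hypDist_le (z : 𝔻) (C : ℝ) : IsCompact {w : 𝔻 | hypDist z w ≤ C} := by
  set C' := hypDist 0 z + C with hC'
  set r := (Real.exp C' - 1) / (Real.exp C' + 1) with hr
  have hr1 : r < 1 := by
    rw [hr, div_lt_one (by positivity)]; linarith
  have hcomp : IsCompact {w : 𝔻 | ‖(w : ℂ)‖ ≤ r} := by
    rw [Complex.UnitDisc.isEmbedding_coe.isCompact_iff]
    convert isCompact_closedBall (0 : ℂ) r
    ext w
    simp only [mem_image, mem_ofPred_eq, mem_closedBall_zero_iff]
    constructor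
    · rintro ⟨x, hx, rfl⟩; exact hx
    · intro hw; exact ⟨Complex.UnitDisc.mk w (hw.trans_lt hr1), hw, rfl⟩
  refine hcomp.of_isClosed_subset
    (isClosed_le (continuous_hypDist_right z) continuous_const) fun w hw => ?_
  have h1 : hypDist w 0 ≤ C' := by
    rw [hypDist_comm]
    exact (hypDist_triangle 0 z w).trans (add_le_add le_rfl hw)
  rw [hypDist_eq, Complex.UnitDisc.coe_zero, pseudoDist_zero_right] at h1
  have hw1 := w.norm_lt_one
  have hw0 := norm_nonneg (w : ℂ)
  rw [Real.log_le_iff_le_exp (div_pos (by linarith) (by linarith)),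
    div_le_iff₀ (by linarith)] at h1
  change ‖(w : ℂ)‖ ≤ r
  rw [hr, le_div_iff₀ (by positivity)]
  linarith

/-! ### Automorphisms -/

theorem IsDiscMobius.hypDist_eq {g : Equiv.Perm 𝔻} (hg : IsDiscMobius g) (z w : 𝔻) :
    hypDist (g z) (g w) = hypDist z w := by
  obtain ⟨u, a, h⟩ := hg
  rw [HypModulus.hypDist_eq, HypModulus.hypDist_eq, h z, h w]
  have := pseudoDist_mobius (u := (u : ℂ)) (Circle.norm_coe u) a.norm_lt_one z.norm_lt_one w.norm_lt_one
  simp only [mobius] at this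
  rw [this]

theorem IsDiscMobius.continuous {g : Equiv.Perm 𝔻} (hg : IsDiscMobius g) : Continuous g := by
  rw [continuous_iff_continuousAt]
  intro z
  refine (nhds_basis_hypDist z).tendsto_iff (nhds_basis_hypDist (g z)) |>.2 fun ε hε =>
    ⟨ε, hε, fun w hw => ?_⟩
  simpa only [mem_ofPred_eq, hg.hypDist_eq] using hw

/-- The derivative is u(1 - |a|²)/(1 - conj a z)². Its being nonzero makes changes of local
coordinates conformal. -/
theorem IsDiscMobius.exists_hasDerivAt {g : Equiv.Perm 𝔻} (hg : IsDiscMobius g) :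
    ∃ M : ℂ → ℂ, (∀ z : 𝔻, (g z : ℂ) = M z) ∧
      ∀ z : 𝔻, ∃ b : ℂ, b ≠ 0 ∧ HasDerivAt M b z := by
  obtain ⟨u, a, h⟩ := hg
  refine ⟨mobius u a, h, fun z => ?_⟩
  have hne : 1 - conj (a : ℂ) * z ≠ 0 := by
    rw [mul_comm]; exact one_sub_mul_conj_ne_zero z.norm_lt_one a.norm_lt_one
  have hd := (((hasDerivAt_id (z : ℂ)).sub_const (a : ℂ)).div
    (((hasDerivAt_id (z : ℂ)).const_mul (conj (a : ℂ))).const_sub 1) hne).const_mul (u : ℂ)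
  refine ⟨_, ?_, hd⟩
  refine mul_ne_zero (Circle.coe_ne_zero u) (div_ne_zero ?_ (pow_ne_zero 2 hne))
  have e : 1 * (1 - conj (a : ℂ) * id (z : ℂ)) - (id (z : ℂ) - a) * -(conj (a : ℂ) * 1) =
      1 - (a : ℂ) * conj (a : ℂ) := by rw [id]; ring
  rw [e]
  exact one_sub_mul_conj_ne_zero a.norm_lt_one a.norm_lt_one

/-! ### Infinitesimal form of the hyperbolic distance -/

/-- The density of the hyperbolic length element. -/
noncomputable def hypDensity (z : ℂ) : ℝ := 2 / (1 - ‖z‖ ^ 2)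

theorem hypDensity_pos {z : ℂ} (hz : ‖z‖ < 1) : 0 < hypDensity z :=
  div_pos two_pos (one_sub_norm_sq_pos hz)

theorem measurable_hypDensity : Measurable hypDensity := by
  unfold hypDensity; fun_prop

/-- The hyperbolic distance as a function of complex numbers. -/
noncomputable def hypDistC (z w : ℂ) : ℝ :=
  Real.log ((1 + pseudoDist z w) / (1 - pseudoDist z w))

/-- The function log((1 + t)/(1 - t)) has derivative 2 at 0, and t is asymptotic to |w - z|/(1 -
|z|²). -/
theorem hypDistC_isLittleO {z : ℂ} (hz : ‖z‖ < 1) :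
    (fun w => hypDistC w z - hypDensity z * ‖w - z‖) =o[𝓝 z] fun w => w - z := by
  have hN : ContinuousAt (fun w => ‖1 - w * conj z‖⁻¹) z := by
    refine ContinuousAt.inv₀ (by fun_prop) (norm_one_sub_mul_conj_pos hz hz).ne'
  have hpd : ∀ w, pseudoDist w z = ‖w - z‖ * ‖1 - w * conj z‖⁻¹ := fun w => div_eq_mul_inv _ _
  have hNz : ‖1 - z * conj z‖⁻¹ = (1 - ‖z‖ ^ 2)⁻¹ := by
    have := norm_one_sub_mul_conj_sq z z
    have h0 := one_sub_norm_sq_pos hz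
    rw [sub_self, norm_zero, zero_pow two_ne_zero, zero_add, ← sq] at this
    rw [(pow_left_inj₀ (norm_nonneg _) h0.le two_ne_zero).1 this]
  have hbig : (fun w => pseudoDist w z) =O[𝓝 z] fun w => w - z := by
    simp only [hpd]
    have h1 : (fun w : ℂ => ‖w - z‖) =O[𝓝 z] fun w => w - z := (Asymptotics.isBigO_refl _ _).norm_left
    have h2 : (fun w => ‖1 - w * conj z‖⁻¹) =O[𝓝 z] fun _ => (1 : ℂ) := hN.tendsto.isBigO_one ℂ
    simpa using h1.mul h2
  have ht0 : Tendsto (fun w => pseudoDist w z) (𝓝 z) (𝓝 0) := by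
    have : ContinuousAt (fun w => ‖w - z‖ * ‖1 - w * conj z‖⁻¹) z := by
      exact ContinuousAt.mul (by fun_prop) hN
    simpa [ContinuousAt, ← hpd, pseudoDist] using this
  have hder : HasDerivAt (fun t : ℝ => Real.log ((1 + t) / (1 - t))) 2 0 := by
    have h1 : HasDerivAt (fun t : ℝ => (1 + t) / (1 - t))
        ((1 * (1 - 0) - (1 + 0) * (-1)) / (1 - 0) ^ 2) 0 :=
      ((hasDerivAt_id (0 : ℝ)).const_add 1).div ((hasDerivAt_id (0 : ℝ)).const_sub 1) (by simp)
    have h2 := h1.log (by simp)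
    convert h2 using 1
    norm_num
  have hl := hasDerivAt_iff_isLittleO.1 hder
  simp only [sub_zero, smul_eq_mul, add_zero, div_one, Real.log_one] at hl
  have A : (fun w => hypDistC w z - pseudoDist w z * 2) =o[𝓝 z] fun w => w - z :=
    (hl.comp_tendsto ht0).trans_isBigO hbig
  have B : (fun w => pseudoDist w z * 2 - hypDensity z * ‖w - z‖) =o[𝓝 z] fun w => w - z := by
    have h1 : (fun w : ℂ => ‖w - z‖) =O[𝓝 z] fun w => w - z := (Asymptotics.isBigO_refl _ _).norm_left
    have h2 : (fun w => 2 * (‖1 - w * conj z‖⁻¹ - (1 - ‖z‖ ^ 2)⁻¹)) =o[𝓝 z] fun _ => (1 : ℂ) := by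
      rw [Asymptotics.isLittleO_one_iff]
      have h3 := (hN.tendsto.sub_const ((1 - ‖z‖ ^ 2)⁻¹)).const_mul 2
      rwa [hNz, sub_self, mul_zero] at h3
    have h4 := h1.mul_isLittleO h2
    simp only [mul_one] at h4
    refine h4.congr_left fun w => ?_
    rw [hpd, hypDensity, div_eq_mul_inv]
    ring
  exact (A.add B).congr_left fun w => by ring

theorem eventually_hypDistC_le {z : ℂ} (hz : ‖z‖ < 1) {ε : ℝ} (hε : 0 < ε) :
    ∀ᶠ w in 𝓝 z, hypDistC w z ≤ (hypDensity z + ε) * ‖w - z‖ ∧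
      (hypDensity z - ε) * ‖w - z‖ ≤ hypDistC w z := by
  filter_upwards [(hypDistC_isLittleO hz).def hε] with w hw
  rw [Real.norm_eq_abs, abs_le] at hw
  constructor <;> linarith

/-! ### The surface `𝔻 / G` as a metric space -/

section Surface

variable {G : Subgroup (Equiv.Perm 𝔻)}

theorem proj_eq_proj_iff {z w : 𝔻} : proj G z = proj G w ↔ ∃ g ∈ G, g w = z := by
  refine (Quotient.eq (r := MulAction.orbitRel G 𝔻)).trans ?_
  constructor
  · rintro ⟨⟨g, hg⟩, h⟩; exact ⟨g, hg, h⟩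
  · rintro ⟨g, hg, h⟩; exact ⟨⟨g, hg⟩, h⟩

theorem proj_apply_eq {g : Equiv.Perm 𝔻} (hg : g ∈ G) (z : 𝔻) : proj G (g z) = proj G z :=
  proj_eq_proj_iff.2 ⟨g, hg, rfl⟩

theorem proj_surjective : Function.Surjective (proj G) := Quotient.mk_surjective

theorem continuous_proj : Continuous (proj G) := continuous_coinduced_rng

theorem IsSurfaceGroup.isOpenMap_proj (hG : IsSurfaceGroup G) : IsOpenMap (proj G) := by
  intro U hU
  change IsOpen (proj G ⁻¹' (proj G '' U))
  have : proj G ⁻¹' (proj G '' U) = ⋃ g ∈ G, (g : 𝔻 → 𝔻) ⁻¹' U := by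
    ext z
    simp only [mem_preimage, mem_image, mem_iUnion, exists_prop, proj_eq_proj_iff]
    constructor
    · rintro ⟨w, hw, g, hg, rfl⟩; exact ⟨g, hg, hw⟩
    · rintro ⟨g, hg, hw⟩; exact ⟨g z, hw, g, hg, rfl⟩
  rw [this]
  exact isOpen_biUnion fun g hg => hU.preimage (hG.mobius g hg).continuous

theorem surfDist_bddBelow (p q : Surface G) :
    BddBelow {r : ℝ | ∃ z w : 𝔻, proj G z = p ∧ proj G w = q ∧ hypDist z w = r} :=
  ⟨0, by rintro _ ⟨z, w, -, -, rfl⟩; exact hypDist_nonneg z w⟩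

theorem surfDist_nonempty (p q : Surface G) :
    {r : ℝ | ∃ z w : 𝔻, proj G z = p ∧ proj G w = q ∧ hypDist z w = r}.Nonempty := by
  obtain ⟨z, rfl⟩ := proj_surjective p
  obtain ⟨w, rfl⟩ := proj_surjective q
  exact ⟨_, z, w, rfl, rfl, rfl⟩

theorem surfDist_proj_le (z w : 𝔻) : surfDist (proj G z) (proj G w) ≤ hypDist z w :=
  csInf_le (surfDist_bddBelow _ _) ⟨z, w, rfl, rfl, rfl⟩

theorem surfDist_nonneg (p q : Surface G) : 0 ≤ surfDist p q :=
  Real.sInf_nonneg (by rintro _ ⟨z, w, -, -, rfl⟩; exact hypDist_nonneg z w)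

theorem surfDist_self (p : Surface G) : surfDist p p = 0 := by
  obtain ⟨z, rfl⟩ := proj_surjective p
  exact le_antisymm ((surfDist_proj_le z z).trans (hypDist_self z).le) (surfDist_nonneg _ _)

theorem surfDist_comm (p q : Surface G) : surfDist p q = surfDist q p := by
  unfold surfDist
  congr 1
  ext r
  constructor <;>
  · rintro ⟨z, w, hz, hw, rfl⟩
    exact ⟨w, z, hw, hz, hypDist_comm w z⟩

/-- Since the group acts by isometries, one lift can be held fixed and only the other moved along
its orbit. -/
theorem IsSurfaceGroup.exists_hypDist_lt (hG : IsSurfaceGroup G) {z w : 𝔻} {ε : ℝ}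
    (h : surfDist (proj G z) (proj G w) < ε) : ∃ g ∈ G, hypDist z (g w) < ε := by
  obtain ⟨_, ⟨z', w', hz, hw, rfl⟩, hlt⟩ := exists_lt_of_csInf_lt (surfDist_nonempty _ _) h
  obtain ⟨g, hg, rfl⟩ := proj_eq_proj_iff.1 hz
  obtain ⟨k, hk, rfl⟩ := proj_eq_proj_iff.1 hw
  refine ⟨g⁻¹ * k, mul_mem (inv_mem hg) hk, ?_⟩
  rw [← (hG.mobius g hg).hypDist_eq]
  simpa using hlt

theorem IsSurfaceGroup.surfDist_triangle (hG : IsSurfaceGroup G) (p q r : Surface G) :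
    surfDist p r ≤ surfDist p q + surfDist q r := by
  obtain ⟨z, rfl⟩ := proj_surjective p
  obtain ⟨a, rfl⟩ := proj_surjective q
  obtain ⟨w, rfl⟩ := proj_surjective r
  refine le_of_forall_pos_le_add fun ε hε => ?_
  obtain ⟨g, hg, h1⟩ := hG.exists_hypDist_lt (lt_add_of_pos_right
    (surfDist (proj G z) (proj G a)) (half_pos hε))
  obtain ⟨k, hk, h2⟩ := hG.exists_hypDist_lt (lt_add_of_pos_right
    (surfDist (proj G a) (proj G w)) (half_pos hε))
  have h3 := surfDist_proj_le (G := G) z (g (k w))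
  rw [proj_apply_eq hg, proj_apply_eq hk] at h3
  have h4 := hypDist_triangle z (g a) (g (k w))
  rw [(hG.mobius g hg).hypDist_eq] at h4
  linarith

theorem IsSurfaceGroup.finite_hypDist_le (hG : IsSurfaceGroup G) (z w : 𝔻) (C : ℝ) :
    {g : Equiv.Perm 𝔻 | g ∈ G ∧ hypDist z (g w) ≤ C}.Finite := by
  refine (hG.discontinuous _ (isCompact_hypDist_le z (max C (hypDist z w)))).subset ?_
  rintro g ⟨hg, h⟩
  exact ⟨hg, g w, ⟨w, le_max_right C (hypDist z w), rfl⟩, h.trans (le_max_left C (hypDist z w))⟩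

/-- Only finitely many orbit points are near z, so a nearest one exists; if it were at positive
distance, the infimum could not be zero. -/
theorem IsSurfaceGroup.eq_of_surfDist_eq_zero (hG : IsSurfaceGroup G) {p q : Surface G}
    (h : surfDist p q = 0) : p = q := by
  obtain ⟨z, rfl⟩ := proj_surjective p
  obtain ⟨w, rfl⟩ := proj_surjective q
  by_contra hne
  have hfin := hG.finite_hypDist_le z w 1
  obtain ⟨g₀, hg₀, h₀⟩ := hG.exists_hypDist_lt (h.trans_lt one_pos)
  obtain ⟨g, hg, hmin⟩ := hfin.exists_minimalFor (fun g => hypDist z (g w)) _ ⟨g₀, hg₀, h₀.le⟩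
  have hpos : 0 < hypDist z (g w) := by
    refine (hypDist_nonneg _ _).lt_of_ne fun h0 => hne ?_
    rw [eq_of_hypDist_eq_zero h0.symm, proj_apply_eq hg.1]
  obtain ⟨k, hk, h1⟩ := hG.exists_hypDist_lt (h.trans_lt hpos)
  exact absurd (hmin ⟨hk, h1.le.trans hg.2⟩ h1.le) (not_le.2 h1)

/-- The metric of the surface, with its topology being the quotient topology. -/
@[reducible] noncomputable def IsSurfaceGroup.metricSpace (hG : IsSurfaceGroup G) :
    MetricSpace (Surface G) :=
  let m : MetricSpace (Surface G) :=
    { dist := surfDist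
      dist_self := surfDist_self
      dist_comm := surfDist_comm
      dist_triangle := hG.surfDist_triangle
      eq_of_dist_eq_zero := hG.eq_of_surfDist_eq_zero }
  -- The projections of hyperbolic balls are exactly the metric balls, and they also form a basis of
  -- the quotient topology because the projection is open.
  m.replaceTopology <| by
    refine TopologicalSpace.ext_nhds fun p => ?_
    obtain ⟨z, rfl⟩ := proj_surjective p
    have h1 : 𝓝 (proj G z) = map (proj G) (𝓝 z) :=
      ((hG.isOpenMap_proj).map_nhds_eq (continuous_proj (G := G)).continuousAt).symm
    rw [h1]
    refine ((nhds_basis_hypDist z).map (proj G)).eq_of_same_basis ?_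
    have h2 := @Metric.nhds_basis_ball _ m.toPseudoMetricSpace (proj G z)
    convert h2 using 2 with ε
    ext q
    obtain ⟨w, rfl⟩ := proj_surjective q
    rw [Metric.mem_ball']
    change _ ↔ surfDist (proj G z) (proj G w) < ε
    constructor
    · rintro ⟨w', h, e⟩
      rw [← e]
      exact (surfDist_proj_le _ _).trans_lt h
    · intro h
      obtain ⟨g, hg, h⟩ := hG.exists_hypDist_lt h
      exact ⟨g w, h, proj_apply_eq hg w⟩

/-! ### The Dirichlet polygon -/

/-- Local finiteness leaves finitely many inequalities to preserve; the remaining ones hold at z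
with margin 2, which a move of hyperbolic length less than 1 cannot use up. -/
theorem IsSurfaceGroup.isOpen_dirichlet (hG : IsSurfaceGroup G) : IsOpen (dirichlet G) := by
  rw [isOpen_iff_mem_nhds]
  intro z hz
  set S := {g : Equiv.Perm 𝔻 | g ∈ G ∧ hypDist z (g 0) ≤ hypDist z 0 + 2} with hS
  have hfin : S.Finite := hG.finite_hypDist_le z 0 _
  have h1 : ∀ᶠ w in 𝓝 z, ∀ g ∈ S, g ≠ 1 → hypDist w 0 < hypDist w (g 0) := by
    rw [eventually_all_finite hfin]
    intro g hg
    by_cases hg1 : g = 1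
    · exact Eventually.of_forall fun w h => absurd hg1 h
    · have c : ∀ a : 𝔻, Continuous fun w => hypDist w a := fun a =>
        continuous_hypDist.comp (Continuous.prodMk continuous_id continuous_const)
      filter_upwards [(c 0).continuousAt.eventually_lt (c (g 0)).continuousAt
        (hz g hg.1 hg1)] with w hw _ using hw
  filter_upwards [h1, (nhds_basis_hypDist z).mem_of_mem one_pos] with w hw hzw g hg hg1
  by_cases hgS : g ∈ S
  · exact hw g hgS hg1
  · have h2 : hypDist z 0 + 2 < hypDist z (g 0) := by
      by_contra hcon
      exact hgS ⟨hg, not_lt.1 hcon⟩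
    have h3 := hypDist_triangle z w (g 0)
    have h4 := hypDist_triangle w z 0
    rw [hypDist_comm w z] at h4
    have h5 : hypDist z w < 1 := hzw
    linarith

/-- Otherwise d(z,0) < d(z,g⁻¹0) = d(gz,0) < d(gz,g0) = d(z,0). -/
theorem IsSurfaceGroup.eq_one_of_dirichlet (hG : IsSurfaceGroup G) {g : Equiv.Perm 𝔻}
    (hg : g ∈ G) {z : 𝔻} (hz : z ∈ dirichlet G) (hgz : g z ∈ dirichlet G) : g = 1 := by
  by_contra hne
  have h1 := hz g⁻¹ (inv_mem hg) (inv_ne_one.2 hne)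
  have h2 := hgz g hg hne
  rw [← (hG.mobius g hg).hypDist_eq z, ← (hG.mobius g hg).hypDist_eq z] at h1
  rw [← Equiv.Perm.mul_apply g g⁻¹, mul_inv_cancel, Equiv.Perm.one_apply] at h1
  exact lt_asymm h1 h2

theorem IsSurfaceGroup.injOn_proj (hG : IsSurfaceGroup G) : InjOn (proj G) (dirichlet G) := by
  intro z hz w hw h
  obtain ⟨g, hg, rfl⟩ := proj_eq_proj_iff.1 h
  rw [hG.eq_one_of_dirichlet hg hw hz, Equiv.Perm.one_apply]

theorem IsSurfaceGroup.isOpenEmbedding_proj (hG : IsSurfaceGroup G) :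
    IsOpenEmbedding fun z : dirichlet G => proj G z :=
  .of_continuous_injective_isOpenMap (continuous_proj.comp continuous_subtype_val)
    (injOn_iff_injective.1 hG.injOn_proj)
    (hG.isOpenMap_proj.comp hG.isOpen_dirichlet.isOpenMap_subtype_val)

/-- Over the open polygon the projection preserves small distances to z: a translate of z closer to
w than z itself would be so near z as to lie in the polygon, hence equal z. -/
theorem IsSurfaceGroup.eventually_hypDist_le_surfDist (hG : IsSurfaceGroup G) {z : 𝔻}
    (hz : z ∈ dirichlet G) :
    ∀ᶠ w in 𝓝 z, hypDist w z ≤ surfDist (proj G w) (proj G z) := by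
  obtain ⟨δ, hδ, hb⟩ := (nhds_basis_hypDist z).mem_iff.1 (hG.isOpen_dirichlet.mem_nhds hz)
  filter_upwards [(nhds_basis_hypDist z).mem_of_mem (half_pos hδ)] with w hw
  have hw : hypDist z w < δ / 2 := hw
  by_contra hcon
  obtain ⟨g, hg, h⟩ := hG.exists_hypDist_lt (not_le.1 hcon)
  have h1 := hypDist_triangle z w (g z)
  rw [hypDist_comm w z] at h
  have h2 : g z ∈ dirichlet G := hb (show hypDist z (g z) < δ by linarith)
  rw [hG.eq_one_of_dirichlet hg hz h2, Equiv.Perm.one_apply, hypDist_comm w z] at h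
  exact lt_irrefl _ h

/-! ### The surface area in the coordinate of the polygon -/

open Classical in
/-- The projection as a function on the complex plane (with a junk value outside the disc). -/
noncomputable def projC (G : Subgroup (Equiv.Perm 𝔻)) (z : ℂ) : Surface G :=
  if h : ‖z‖ < 1 then proj G (Complex.UnitDisc.mk z h) else proj G 0

@[simp] theorem projC_coe (z : 𝔻) : projC G z = proj G z := by
  simp [projC, z.norm_lt_one]

/-- The Dirichlet polygon as a subset of the complex plane. -/
def dirichletC (G : Subgroup (Equiv.Perm 𝔻)) : Set ℂ := (fun z : 𝔻 => (z : ℂ)) '' dirichlet G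

theorem isOpenEmbedding_coe : IsOpenEmbedding fun z : 𝔻 => (z : ℂ) := by
  refine ⟨Complex.UnitDisc.isEmbedding_coe, ?_⟩
  convert Metric.isOpen_ball (x := (0 : ℂ)) (ε := 1)
  ext z
  simp only [mem_range, mem_ball_zero_iff]
  exact ⟨fun ⟨w, hw⟩ => hw ▸ w.norm_lt_one, fun h => ⟨Complex.UnitDisc.mk z h, rfl⟩⟩

theorem IsSurfaceGroup.isOpen_dirichletC (hG : IsSurfaceGroup G) : IsOpen (dirichletC G) :=
  isOpenEmbedding_coe.isOpenMap _ hG.isOpen_dirichlet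

theorem norm_lt_one_of_mem_dirichletC {z : ℂ} (hz : z ∈ dirichletC G) : ‖z‖ < 1 := by
  obtain ⟨w, -, rfl⟩ := hz
  exact w.norm_lt_one

theorem IsSurfaceGroup.injOn_projC (hG : IsSurfaceGroup G) :
    InjOn (projC G) (dirichletC G) := by
  rintro _ ⟨z, hz, rfl⟩ _ ⟨w, hw, rfl⟩ h
  simp only [projC_coe] at h
  rw [hG.injOn_proj hz hw h]

theorem continuousOn_projC : ContinuousOn (projC G) (Metric.ball 0 1) := by
  intro z hz
  refine ContinuousAt.continuousWithinAt ?_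
  lift z to 𝔻 using by simpa using hz
  rw [isOpenEmbedding_coe.continuousAt_iff.symm]
  have : projC G ∘ (fun z : 𝔻 => (z : ℂ)) = proj G := funext projC_coe
  rw [this]
  exact continuous_proj.continuousAt

theorem dirichletC_subset_ball : dirichletC G ⊆ Metric.ball 0 1 := fun z hz => by
  simpa using norm_lt_one_of_mem_dirichletC hz

theorem IsSurfaceGroup.area_apply (hG : IsSurfaceGroup G) (E : Set (Surface G)) :
    area G E = hypArea (dirichlet G ∩ proj G ⁻¹' E) := by
  have hm : MeasurableSet (dirichlet G) := hG.isOpen_dirichlet.measurableSet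
  rw [area, ← map_comap_subtype_coe hm,
    Measure.map_map continuous_proj.measurable measurable_subtype_coe]
  have e := hG.isOpenEmbedding_proj.measurableEmbedding
  rw [show proj G ∘ (Subtype.val : dirichlet G → 𝔻) = fun z : dirichlet G => proj G z from rfl,
    e.map_apply, (MeasurableEmbedding.subtype_coe hm).comap_apply]
  congr 1
  ext z
  simp [and_comm]

theorem IsSurfaceGroup.area_eq_zero_iff (hG : IsSurfaceGroup G) {E : Set (Surface G)} :
    area G E = 0 ↔ volume (dirichletC G ∩ projC G ⁻¹' E) = 0 := by
  rw [hG.area_apply, hypArea, isOpenEmbedding_coe.measurableEmbedding.comap_apply,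
    withDensity_apply_eq_zero' (by fun_prop)]
  have : {x : ℂ | ENNReal.ofReal (4 / (1 - ‖x‖ ^ 2) ^ 2) ≠ 0} ∩
      (fun z : 𝔻 => (z : ℂ)) '' (dirichlet G ∩ proj G ⁻¹' E) = dirichletC G ∩ projC G ⁻¹' E := by
    ext z
    constructor
    · rintro ⟨-, w, ⟨hw, hE⟩, rfl⟩
      exact ⟨⟨w, hw, rfl⟩, by simpa using hE⟩
    · rintro ⟨⟨w, hw, rfl⟩, hE⟩
      refine ⟨?_, w, ⟨hw, by simpa using hE⟩, rfl⟩
      have := one_sub_norm_sq_pos w.norm_lt_one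
      simp only [mem_ofPred_eq, ne_eq, ENNReal.ofReal_eq_zero, not_le]
      positivity
  rw [this]

/-- The projection is a measurable embedding on the polygon, so h may be arbitrary. This matters
because the dilatation is an infimum over uncountably many linear maps, with no measurability at
hand. -/
theorem IsSurfaceGroup.lintegral_area (hG : IsSurfaceGroup G) (h : Surface G → ℝ≥0∞) :
    ∫⁻ p, h p ∂(area G) =
      ∫⁻ z in dirichletC G, ENNReal.ofReal (hypDensity z ^ 2) * h (projC G z) := by
  have hm : MeasurableSet (dirichlet G) := hG.isOpen_dirichlet.measurableSet
  have hmC : MeasurableSet (dirichletC G) := hG.isOpen_dirichletC.measurableSet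
  have e := hG.isOpenEmbedding_proj.measurableEmbedding
  have ec := isOpenEmbedding_coe.measurableEmbedding
  have h1 : ∫⁻ p, h p ∂(area G) = ∫⁻ z in dirichlet G, h (proj G z) ∂hypArea := by
    rw [area, ← map_comap_subtype_coe hm,
      Measure.map_map continuous_proj.measurable measurable_subtype_coe,
      show proj G ∘ (Subtype.val : dirichlet G → 𝔻) = fun z : dirichlet G => proj G z from rfl,
      e.lintegral_map, (MeasurableEmbedding.subtype_coe hm).lintegral_map]
  have h2 : ∫⁻ z in dirichlet G, h (proj G z) ∂hypArea =
      ∫⁻ z in dirichletC G, h (projC G z) ∂((volume : Measure ℂ).withDensity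
        (fun z => ENNReal.ofReal (4 / (1 - ‖z‖ ^ 2) ^ 2))) := by
    set μ := (volume : Measure ℂ).withDensity fun z => ENNReal.ofReal (4 / (1 - ‖z‖ ^ 2) ^ 2)
    have : μ.restrict (dirichletC G) =
        (hypArea.restrict (dirichlet G)).map fun z : 𝔻 => (z : ℂ) := by
      rw [← ec.injective.preimage_image (dirichlet G), ← ec.restrict_map, hypArea, ec.map_comap,
        Measure.restrict_restrict (ec.measurableSet_image.2 hm),
        inter_eq_left.2 (image_subset_range _ _)]
      rfl
    rw [this, ec.lintegral_map]
    simp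
  have hd : (fun z : ℂ => ENNReal.ofReal (4 / (1 - ‖z‖ ^ 2) ^ 2)) =
      fun z => ENNReal.ofReal (hypDensity z ^ 2) := by
    funext z
    rw [hypDensity, div_pow]
    norm_num
  rw [h1, h2, hd, setLIntegral_withDensity_eq_setLIntegral_mul_non_measurable _ _ _ hmC]
  · rfl
  · exact Eventually.of_forall fun _ => ENNReal.ofReal_lt_top
  · exact (measurable_hypDensity.pow_const 2).ennreal_ofReal

end Surface

/-! ### Real linear maps of the plane -/

section Linear

theorem apply_eq_dz_add_dzbar (A : ℂ →L[ℝ] ℂ) (v : ℂ) :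
    A v = dz A * v + dzbar A * conj v := by
  have h : A v = v.re * A 1 + v.im * A Complex.I := by
    conv_lhs => rw [show v = v.re • (1 : ℂ) + v.im • Complex.I by
      simp [Complex.re_add_im]]
    rw [map_add, map_smul, map_smul, Complex.real_smul, Complex.real_smul]
  have h2 : conj v = v.re - v.im * Complex.I := by
    apply Complex.ext <;> simp
  rw [h, h2]
  conv_rhs => rw [← Complex.re_add_im v]
  simp only [dz, dzbar, Complex.add_re, Complex.ofReal_re, Complex.mul_re, Complex.I_re, mul_zero,
    Complex.ofReal_im, Complex.I_im, mul_one, sub_self, add_zero, Complex.add_im, Complex.mul_im,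
    zero_add]
  linear_combination ((v.im : ℂ) * A Complex.I) * Complex.I_mul_I

theorem det_eq_norm_dz_sq_sub (A : ℂ →L[ℝ] ℂ) : A.det = ‖dz A‖ ^ 2 - ‖dzbar A‖ ^ 2 := by
  rw [ContinuousLinearMap.det, ← LinearMap.det_toMatrix Complex.basisOneI, Matrix.det_fin_two]
  simp only [LinearMap.toMatrix_apply, Complex.coe_basisOneI, Complex.coe_basisOneI_repr,
    Matrix.cons_val_zero, Matrix.cons_val_one, ContinuousLinearMap.coe_coe, Complex.sq_norm,
    Complex.normSq_apply, dz, dzbar]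
  simp
  ring

/-- The smallest stretching `| |A_z| - |A_z̄| |` of a real linear map. -/
noncomputable def minStretch (A : ℂ →L[ℝ] ℂ) : ℝ := |‖dz A‖ - ‖dzbar A‖|

theorem minStretch_pos {A : ℂ →L[ℝ] ℂ} (hA : A.det ≠ 0) : 0 < minStretch A := by
  rw [minStretch, abs_pos]
  intro h
  apply hA
  rw [det_eq_norm_dz_sq_sub, sub_eq_zero.1 h, sub_self]

theorem minStretch_mul_norm_le (A : ℂ →L[ℝ] ℂ) (v : ℂ) : minStretch A * ‖v‖ ≤ ‖A v‖ := by
  rw [apply_eq_dz_add_dzbar, minStretch]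
  have h := abs_norm_sub_norm_le (dz A * v) (-(dzbar A * conj v))
  rw [sub_neg_eq_add, norm_neg, norm_mul, norm_mul, Complex.norm_conj, ← sub_mul, abs_mul,
    abs_norm] at h
  exact h

/-- The determinant factors as (|A_z| + |A_z̄|)(|A_z| - |A_z̄|). In this form the dilatation is what
the change of variables produces. -/
theorem linDilatation_eq {A : ℂ →L[ℝ] ℂ} (hA : A.det ≠ 0) :
    linDilatation A = ENNReal.ofReal (|A.det| / minStretch A ^ 2) := by
  have hl := minStretch_pos hA
  rw [linDilatation, if_pos (det_eq_norm_dz_sq_sub A ▸ hA), det_eq_norm_dz_sq_sub, sq_sub_sq,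
    abs_mul, abs_of_nonneg (add_nonneg (norm_nonneg _) (norm_nonneg _))]
  rw [minStretch] at hl ⊢
  congr 1
  rw [div_eq_div_iff hl.ne' (pow_ne_zero 2 hl.ne')]
  ring

/-- Conformal changes of coordinates multiply |A_z| and |A_z̄| by the same factor |a||b|, which
cancels. -/
theorem linDilatation_congr {A B : ℂ →L[ℝ] ℂ} {a b : ℂ} (ha : a ≠ 0) (hb : b ≠ 0)
    (h : ∀ v, B v = a * A (b * v)) : linDilatation B = linDilatation A := by
  have hB : ∀ v, B v = a * (dz A * (b * v) + dzbar A * (conj b * conj v)) := fun v => by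
    rw [h, apply_eq_dz_add_dzbar A, map_mul]
  have h1 : dz B = a * b * dz A := by
    rw [dz, hB, hB, map_one, Complex.conj_I]
    linear_combination (a * (dzbar A * conj b - dz A * b) / 2) * Complex.I_mul_I
  have h2 : dzbar B = a * conj b * dzbar A := by
    rw [dzbar, hB, hB, map_one, Complex.conj_I]
    linear_combination (a * (dz A * b - dzbar A * conj b) / 2) * Complex.I_mul_I
  have hc : 0 < ‖a‖ * ‖b‖ := mul_pos (norm_pos_iff.2 ha) (norm_pos_iff.2 hb)
  have n1 : ‖dz B‖ = ‖a‖ * ‖b‖ * ‖dz A‖ := by rw [h1, norm_mul, norm_mul]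
  have n2 : ‖dzbar B‖ = ‖a‖ * ‖b‖ * ‖dzbar A‖ := by
    rw [h2, norm_mul, norm_mul, Complex.norm_conj]
  set c := ‖a‖ * ‖b‖
  have e1 : (c * ‖dz A‖) ^ 2 - (c * ‖dzbar A‖) ^ 2 = c ^ 2 * (‖dz A‖ ^ 2 - ‖dzbar A‖ ^ 2) := by ring
  have e2 : c * ‖dz A‖ + c * ‖dzbar A‖ = c * (‖dz A‖ + ‖dzbar A‖) := by ring
  have e3 : |c * ‖dz A‖ - c * ‖dzbar A‖| = c * |‖dz A‖ - ‖dzbar A‖| := by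
    rw [← mul_sub, abs_mul, abs_of_pos hc]
  simp only [linDilatation, n1, n2, e1, e2, e3, mul_div_mul_left _ _ hc.ne', ne_eq, mul_eq_zero,
    pow_eq_zero_iff two_ne_zero, hc.ne', false_or]

/-- A set on which `F` has invertible derivatives is the disjoint union of countably many
relatively measurable parts on which `F` is injective. -/
theorem exists_partition_injOn {F : ℂ → ℂ} {s : Set ℂ} {F' : ℂ → ℂ →L[ℝ] ℂ}
    (hF : ∀ z ∈ s, HasFDerivAt F (F' z) z) (hdet : ∀ z ∈ s, (F' z).det ≠ 0) :
    ∃ t : ℕ → Set ℂ, Pairwise (Function.onFun Disjoint t) ∧ (∀ n, MeasurableSet (t n)) ∧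
      s ⊆ ⋃ n, t n ∧ ∀ n, InjOn F (s ∩ t n) := by
  classical
  rcases s.eq_empty_or_nonempty with rfl | hne
  · exact ⟨fun _ => ∅, fun _ _ _ => by simp [Function.onFun], fun _ => MeasurableSet.empty, by simp,
      fun _ => by simp⟩
  -- An error below half the smallest stretching cannot identify two points. The value 1 is never
  -- used, since each approximating map is the derivative at some point of s.
  let r : (ℂ →L[ℝ] ℂ) → NNReal := fun A =>
    if A.det = 0 then 1 else Real.toNNReal (minStretch A / 2)
  have hr : ∀ A, r A ≠ 0 := fun A => by
    by_cases h : A.det = 0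
    · simp [r, h]
    · simp only [r, h, if_false]
      exact (Real.toNNReal_pos.2 (half_pos (minStretch_pos h))).ne'
  obtain ⟨t, A, hd, hm, hs, hA, hy⟩ := exists_partition_approximatesLinearOn_of_hasFDerivWithinAt
    F s F' (fun z hz => (hF z hz).hasFDerivWithinAt) r hr
  refine ⟨t, hd, hm, hs, fun n x hx y hy' hxy => ?_⟩
  obtain ⟨w, hw, hAw⟩ := hy hne n
  have hdn : (A n).det ≠ 0 := hAw ▸ hdet w hw
  have hp := minStretch_pos hdn
  have h1 := hA n x hx y hy'
  rw [hxy, sub_self, zero_sub, norm_neg] at h1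
  have h2 := minStretch_mul_norm_le (A n) (x - y)
  simp only [r, hdn, if_false] at h1
  rw [Real.coe_toNNReal _ (half_pos hp).le] at h1
  by_contra hne'
  have h3 : 0 < ‖x - y‖ := norm_pos_iff.2 (sub_ne_zero.2 hne')
  nlinarith [mul_pos hp h3]

end Linear

/-! ### The coordinate expression of a map of surfaces -/

section Coord

variable {G G' : Subgroup (Equiv.Perm 𝔻)}

/-- The inverse of the projection on the Dirichlet polygon. -/
noncomputable def sectionC (G : Subgroup (Equiv.Perm 𝔻)) : Surface G → ℂ :=
  Function.invFunOn (projC G) (dirichletC G)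

theorem IsSurfaceGroup.sectionC_projC (hG : IsSurfaceGroup G) {z : ℂ} (hz : z ∈ dirichletC G) :
    sectionC G (projC G z) = z :=
  hG.injOn_projC.leftInvOn_invFunOn hz

/-- The expression of `f` in the coordinates given by the Dirichlet polygons. -/
noncomputable def coordMap (f : Surface G → Surface G') (z : ℂ) : ℂ :=
  sectionC G' (f (projC G z))

/-- The domain of the coordinate expression of `f : D → 𝔻 / G'`. -/
def coordDomain (f : Surface G → Surface G') (D : Set (Surface G)) : Set ℂ :=
  {z | z ∈ dirichletC G ∧ projC G z ∈ D ∧ f (projC G z) ∈ projC G' '' dirichletC G'}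

variable {f : Surface G → Surface G'} {D : Set (Surface G)}

theorem coordMap_mem {z : ℂ} (hz : z ∈ coordDomain f D) : coordMap f z ∈ dirichletC G' :=
  Function.invFunOn_mem hz.2.2

theorem projC_coordMap {z : ℂ} (hz : z ∈ coordDomain f D) :
    projC G' (coordMap f z) = f (projC G z) :=
  Function.invFunOn_eq hz.2.2

theorem IsSurfaceGroup.map_projC_nhds (hG : IsSurfaceGroup G) {z : ℂ} (hz : ‖z‖ < 1) :
    map (projC G) (𝓝 z) = 𝓝 (projC G z) := by
  lift z to 𝔻 using hz
  rw [← isOpenEmbedding_coe.map_nhds_eq, map_map,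
    show projC G ∘ (fun z : 𝔻 => (z : ℂ)) = proj G from funext projC_coe, projC_coe]
  exact hG.isOpenMap_proj.map_nhds_eq continuous_proj.continuousAt

theorem IsSurfaceGroup.isOpen_projC_image (hG : IsSurfaceGroup G) {U : Set ℂ} (hU : IsOpen U)
    (h1 : U ⊆ dirichletC G) : IsOpen (projC G '' U) := by
  rw [isOpen_iff_mem_nhds]
  rintro _ ⟨z, hz, rfl⟩
  rw [← hG.map_projC_nhds (norm_lt_one_of_mem_dirichletC (h1 hz))]
  exact image_mem_map (hU.mem_nhds hz)

theorem isOpen_coordDomain (hG : IsSurfaceGroup G) (hG' : IsSurfaceGroup G') (hD : IsOpen D)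
    (hf : ContinuousOn f D) : IsOpen (coordDomain f D) := by
  have h1 : IsOpen (dirichletC G ∩ projC G ⁻¹' D) :=
    (continuousOn_projC.mono dirichletC_subset_ball).isOpen_inter_preimage hG.isOpen_dirichletC hD
  have h2 : ContinuousOn (fun z => f (projC G z)) (dirichletC G ∩ projC G ⁻¹' D) :=
    hf.comp (continuousOn_projC.mono (inter_subset_left.trans dirichletC_subset_ball))
      fun z hz => hz.2
  have h3 := h2.isOpen_inter_preimage h1 (hG'.isOpen_projC_image hG'.isOpen_dirichletC le_rfl)
  convert h3 using 1
  ext z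
  simp only [coordDomain, mem_ofPred_eq, mem_inter_iff, mem_preimage, and_assoc]

/-- A local derivative of `f` yields, up to conformal factors, the derivative of the coordinate
expression. -/
theorem HasLocalDeriv.exists_hasFDerivAt (hG : IsSurfaceGroup G) (hG' : IsSurfaceGroup G')
    (hD : IsOpen D) (hf : ContinuousOn f D) {z : ℂ} (hz : z ∈ coordDomain f D) {A : ℂ →L[ℝ] ℂ}
    (hA : HasLocalDeriv f (projC G z) A) :
    ∃ B : ℂ →L[ℝ] ℂ, HasFDerivAt (coordMap f) B z ∧ linDilatation B = linDilatation A := by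
  have hΩ := (isOpen_coordDomain hG hG' hD hf).mem_nhds hz
  obtain ⟨z₁, F₁, hz₁, hF₁, hd⟩ := hA
  obtain ⟨z, hzd, rfl⟩ := id hz.1
  obtain ⟨w, hwd, hw⟩ := coordMap_mem hz
  have hw' : (w : ℂ) = coordMap f z := hw
  have hzp : proj G' w = f (proj G z) := by
    have := projC_coordMap hz
    rwa [← hw', projC_coe, projC_coe] at this
  rw [projC_coe] at hz₁
  obtain ⟨g, hg, rfl⟩ := proj_eq_proj_iff.1 hz₁
  obtain ⟨M, hM, hM'⟩ := (hG.mobius g hg).exists_hasDerivAt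
  obtain ⟨b, hb, hMb⟩ := hM' z
  obtain ⟨w₁, hw₁, hpw₁⟩ := hF₁.self_of_nhds
  rw [proj_apply_eq hg, ← hzp] at hpw₁
  obtain ⟨k, hk, rfl⟩ := proj_eq_proj_iff.1 hpw₁
  have hk' := inv_mem hk
  obtain ⟨N, hN, hN'⟩ := (hG'.mobius k⁻¹ hk').exists_hasDerivAt
  obtain ⟨a, ha, hNa⟩ := hN' (k w)
  rw [hw₁, hM z] at hNa
  rw [hM z] at hd
  have hcomp : HasFDerivAt (fun ζ => N (F₁ (M ζ))) _ (z : ℂ) :=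
    (hNa.hasFDerivAt.restrictScalars ℝ).comp (z : ℂ)
      (hd.comp (z : ℂ) (hMb.hasFDerivAt.restrictScalars ℝ))
  have hcont : ContinuousAt (fun ζ => F₁ (M ζ)) (z : ℂ) :=
    (hd.comp (z : ℂ) (hMb.hasFDerivAt.restrictScalars ℝ)).continuousAt
  -- On this neighbourhood k⁻¹ brings the values of the given lifting into the polygon of G', where
  -- the projection is injective; so N ∘ F₁ ∘ M must be the coordinate expression near z.
  have hW : (fun x : 𝔻 => (x : ℂ)) '' (⇑k⁻¹ ⁻¹' dirichlet G') ∈ 𝓝 (F₁ (M z)) := by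
    refine (isOpenEmbedding_coe.isOpenMap _
      (hG'.isOpen_dirichlet.preimage (hG'.mobius k⁻¹ hk').continuous)).mem_nhds ⟨k w, ?_, ?_⟩
    · simpa using hwd
    · simpa only [← hM z] using hw₁
  have hF₂ : ∀ᶠ ζ : ℂ in 𝓝 (z : ℂ), ∃ x : 𝔻, (x : ℂ) = F₁ (M ζ) ∧ proj G' x = f (projC G ζ) := by
    rw [← isOpenEmbedding_coe.map_nhds_eq, eventually_map]
    filter_upwards [((hG.mobius g hg).continuous.tendsto z).eventually hF₁] with ζ hζ
    obtain ⟨x, hx, hxp⟩ := hζ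
    exact ⟨x, by rw [hx, hM ζ], by rw [hxp, proj_apply_eq hg, projC_coe]⟩
  have hev : coordMap f =ᶠ[𝓝 (z : ℂ)] fun ζ => N (F₁ (M ζ)) := by
    filter_upwards [hΩ, hcont.preimage_mem_nhds hW, hF₂] with ζ hζ hζW hζF
    obtain ⟨x, hx, hxp⟩ := hζF
    obtain ⟨y, hy, hyx⟩ := hζW
    have hyx : (y : ℂ) = F₁ (M ζ) := hyx
    obtain rfl : y = x := Complex.UnitDisc.coe_injective (hyx.trans hx.symm)
    rw [← hx, ← hN]
    refine hG'.injOn_projC (coordMap_mem hζ) ⟨k⁻¹ y, hy, rfl⟩ ?_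
    rw [projC_coordMap hζ, projC_coe, proj_apply_eq hk', hxp]
  refine ⟨_, hcomp.congr_of_eventuallyEq hev, linDilatation_congr ha hb fun v => ?_⟩
  simp [mul_comm]

theorem surfDist_projC_le {z w : ℂ} (hz : ‖z‖ < 1) (hw : ‖w‖ < 1) :
    surfDist (projC G z) (projC G w) ≤ hypDistC z w := by
  lift z to 𝔻 using hz
  lift w to 𝔻 using hw
  rw [projC_coe, projC_coe]
  exact surfDist_proj_le z w

theorem IsSurfaceGroup.eventually_hypDistC_le_surfDist (hG : IsSurfaceGroup G) {z : ℂ}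
    (hz : z ∈ dirichletC G) :
    ∀ᶠ w in 𝓝 z, hypDistC w z ≤ surfDist (projC G w) (projC G z) := by
  obtain ⟨z, hzd, rfl⟩ := hz
  rw [← isOpenEmbedding_coe.map_nhds_eq, eventually_map]
  filter_upwards [hG.eventually_hypDist_le_surfDist hzd] with w hw
  rw [projC_coe, projC_coe]
  exact hw

/-- The reciprocal of the smallest hyperbolic stretching of `f` at the point with coordinate `z`. -/
noncomputable def invStretch (f : Surface G → Surface G') (z : ℂ) : ℝ≥0∞ :=
  ENNReal.ofReal (hypDensity z /
    (hypDensity (coordMap f z) * minStretch (fderiv ℝ (coordMap f) z)))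

/-- Near a point where the derivative is invertible, `f` expands distances by almost its smallest
stretching. -/
theorem eventually_surfDist_le (hG : IsSurfaceGroup G) (hG' : IsSurfaceGroup G')
    (hD : IsOpen D) (hf : ContinuousOn f D) {z : ℂ} (hz : z ∈ coordDomain f D)
    (hd : DifferentiableAt ℝ (coordMap f) z) (hdet : (fderiv ℝ (coordMap f) z).det ≠ 0)
    {c : NNReal} (hc : invStretch f z < c) :
    ∀ᶠ p in 𝓝 (projC G z), surfDist p (projC G z) ≤ c * surfDist (f p) (f (projC G z)) := by
  have hz1 := norm_lt_one_of_mem_dirichletC hz.1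
  have hw := coordMap_mem hz
  have hw1 := norm_lt_one_of_mem_dirichletC hw
  have hl := minStretch_pos hdet
  have hκ := hypDensity_pos hz1
  have hκ' := hypDensity_pos hw1
  rw [invStretch, ← ENNReal.ofReal_coe_nnreal, ENNReal.ofReal_lt_ofReal_iff_of_nonneg (by positivity),
    div_lt_iff₀ (by positivity)] at hc
  set A := fderiv ℝ (coordMap f) z
  set l := minStretch A
  set κ := hypDensity z
  set κ' := hypDensity (coordMap f z)
  -- The strict inequality κ < c κ' l leaves room for errors ε in both length densities and in the
  -- linear approximation.
  have hε : ∀ᶠ ε in 𝓝[>] (0 : ℝ), κ + ε < c * ((κ' - ε) * (l - ε)) ∧ ε < κ' ∧ ε < l := by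
    refine nhdsWithin_le_nhds ?_
    refine Eventually.and ?_ ((eventually_lt_nhds hκ').and (eventually_lt_nhds hl))
    have h1 : ContinuousAt (fun ε : ℝ => κ + ε) 0 := by fun_prop
    have h2 : ContinuousAt (fun ε : ℝ => c * ((κ' - ε) * (l - ε))) 0 := by fun_prop
    exact h1.eventually_lt h2 (by simpa using hc)
  obtain ⟨ε, ⟨hε1, hε2, hε3⟩, hε0 : 0 < ε⟩ := (hε.and self_mem_nhdsWithin).exists
  rw [← hG.map_projC_nhds hz1, eventually_map]
  have hFc : Tendsto (coordMap f) (𝓝 z) (𝓝 (coordMap f z)) := hd.continuousAt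
  filter_upwards [(isOpen_coordDomain hG hG' hD hf).mem_nhds hz, eventually_hypDistC_le hz1 hε0,
    hFc.eventually (eventually_hypDistC_le hw1 hε0),
    hFc.eventually (hG'.eventually_hypDistC_le_surfDist hw),
    (hasFDerivAt_iff_isLittleO.1 hd.hasFDerivAt).def hε0] with ζ hζ h1 h2 h3 h4
  rw [← projC_coordMap hζ, ← projC_coordMap hz]
  have h5 : (l - ε) * ‖ζ - z‖ ≤ ‖coordMap f ζ - coordMap f z‖ := by
    have h6 := minStretch_mul_norm_le A (ζ - z)
    have h7 := norm_sub_norm_le (A (ζ - z)) (coordMap f ζ - coordMap f z)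
    rw [norm_sub_rev (A (ζ - z))] at h7
    linarith
  calc surfDist (projC G ζ) (projC G z) ≤ hypDistC ζ z :=
        surfDist_projC_le (norm_lt_one_of_mem_dirichletC hζ.1) hz1
    _ ≤ (κ + ε) * ‖ζ - z‖ := h1.1
    _ ≤ c * ((κ' - ε) * (l - ε)) * ‖ζ - z‖ := mul_le_mul_of_nonneg_right hε1.le (norm_nonneg _)
    _ = c * ((κ' - ε) * ((l - ε) * ‖ζ - z‖)) := by ring
    _ ≤ c * ((κ' - ε) * ‖coordMap f ζ - coordMap f z‖) := by
        refine mul_le_mul_of_nonneg_left ?_ c.2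
        exact mul_le_mul_of_nonneg_left h5 (by linarith)
    _ ≤ c * surfDist (projC G' (coordMap f ζ)) (projC G' (coordMap f z)) :=
        mul_le_mul_of_nonneg_left (h2.2.trans h3) c.2

end Coord

/-! ### The test function on the image surface and its energy -/

section TestFunction

variable {G G' : Subgroup (Equiv.Perm 𝔻)} {f : Surface G → Surface G'} {D : Set (Surface G)}
  {D' : Set (Surface G')}

/-- The points of the coordinate domain at which the derivative of `f` is invertible. -/
def regularSet (f : Surface G → Surface G') (D : Set (Surface G)) : Set ℂ :=
  {z | z ∈ coordDomain f D ∧ DifferentiableAt ℝ (coordMap f) z ∧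
    (fderiv ℝ (coordMap f) z).det ≠ 0}

theorem measurableSet_regularSet (hG : IsSurfaceGroup G) (hG' : IsSurfaceGroup G')
    (hD : IsOpen D) (hf : ContinuousOn f D) : MeasurableSet (regularSet f D) :=
  (isOpen_coordDomain hG hG' hD hf).measurableSet.inter
    ((measurableSet_of_differentiableAt ℝ _).inter
      ((ContinuousLinearMap.continuous_det.measurable.comp (measurable_fderiv ℝ _))
        (measurableSet_singleton 0).compl))

/-- The points of `D` outside the regular set have area zero. -/
theorem area_diff_regularSet (hG : IsSurfaceGroup G) (hG' : IsSurfaceGroup G')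
    (hD : IsOpen D) (hf : ContinuousOn f D) (hfD : f '' D = D') (hdiff : AEDifferentiable f D)
    (hNinv : LusinNInv f D D') : area G (D \ projC G '' regularSet f D) = 0 := by
  -- N is null by the definition of area, which only sees the polygon.
  set N : Set (Surface G') := D' \ projC G' '' dirichletC G' with hN
  set C : Set ℂ := {z | z ∈ coordDomain f D ∧ DifferentiableAt ℝ (coordMap f) z ∧
    (fderiv ℝ (coordMap f) z).det = 0} with hC
  have h1 : area G (D ∩ f ⁻¹' N) = 0 := by
    refine hNinv N sdiff_subset (hG'.area_eq_zero_iff.2 ?_)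
    convert measure_empty (μ := (volume : Measure ℂ))
    rw [eq_empty_iff_forall_notMem]
    exact fun z hz => hz.2.2 ⟨z, hz.1, rfl⟩
  have h2 : area G {p | ¬ (p ∈ D → ∃ A : ℂ →L[ℝ] ℂ, HasLocalDeriv f p A)} = 0 := hdiff
  -- Sard's theorem makes the image of the critical set null, and the N⁻¹-property carries this back
  -- to the critical set.
  have h3 : area G (D ∩ f ⁻¹' (f '' (projC G '' C))) = 0 := by
    refine hNinv _ ?_ (hG'.area_eq_zero_iff.2 ?_)
    · rw [← hfD]
      refine image_mono ?_
      rintro _ ⟨z, hz, rfl⟩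
      exact hz.1.2.1
    · have hsard : volume (coordMap f '' C) = 0 :=
        addHaar_image_eq_zero_of_det_fderivWithin_eq_zero volume
          (fun z hz => hz.2.1.hasFDerivAt.hasFDerivWithinAt) fun z hz => hz.2.2
      refine measure_mono_null ?_ hsard
      rintro w ⟨hw, _, ⟨z, hz, rfl⟩, he⟩
      refine ⟨z, hz, ?_⟩
      rw [coordMap, he, hG'.sectionC_projC hw]
  rw [hG.area_eq_zero_iff] at h1 h2 h3 ⊢
  refine measure_mono_null ?_ (measure_union_null h1 (measure_union_null h2 h3))
  rintro z ⟨hz, hzD, hzr⟩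
  by_cases hzΩ : z ∈ coordDomain f D
  · right
    by_cases hzd : DifferentiableAt ℝ (coordMap f) z
    · right
      by_cases hdet : (fderiv ℝ (coordMap f) z).det = 0
      · exact ⟨hz, hzD, projC G z, ⟨z, ⟨hzΩ, hzd, hdet⟩, rfl⟩, rfl⟩
      · exact absurd ⟨z, ⟨hzΩ, hzd, hdet⟩, rfl⟩ hzr
    · left
      refine ⟨hz, fun hcon => hzd ?_⟩
      obtain ⟨A, hA⟩ := hcon hzD
      obtain ⟨B, hB, -⟩ := hA.exists_hasFDerivAt hG hG' hD hf hzΩ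
      exact hB.differentiableAt
  · left
    exact ⟨hz, hzD, hfD ▸ mem_image_of_mem f hzD, fun h => hzΩ ⟨hz, hzD, h⟩⟩

/-- All local derivatives at a regular point give the dilatation of the coordinate expression. -/
theorem le_dilatation (hG : IsSurfaceGroup G) (hG' : IsSurfaceGroup G')
    (hD : IsOpen D) (hf : ContinuousOn f D) {z : ℂ} (hz : z ∈ coordDomain f D) :
    linDilatation (fderiv ℝ (coordMap f) z) ≤ dilatation f (projC G z) := by
  refine le_iInf₂ fun A hA => ?_
  obtain ⟨B, hB, hBA⟩ := hA.exists_hasFDerivAt hG hG' hD hf hz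
  rw [hB.fderiv, hBA]

theorem measurable_invStretch {B : Set ℂ} (hB : ContinuousOn (coordMap f) B) :
    Measurable fun z : B => invStretch f z := by
  have hF : Measurable fun z : B => coordMap f z :=
    (continuousOn_iff_continuous_domRestrict.1 hB).measurable
  have hdz : Measurable fun z : ℂ => minStretch (fderiv ℝ (coordMap f) z) := by
    have h1 := measurable_fderiv_apply_const ℝ (coordMap f) 1
    have h2 := measurable_fderiv_apply_const ℝ (coordMap f) Complex.I
    unfold minStretch dz dzbar
    exact (((h1.sub (h2.const_mul _)).div_const 2).norm.sub
      ((h1.add (h2.const_mul _)).div_const 2).norm).norm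
  exact ((measurable_hypDensity.comp measurable_subtype_coe).div
    ((measurable_hypDensity.comp hF).mul (hdz.comp measurable_subtype_coe))).ennreal_ofReal

/-- Pushing `ρ` forward along an injective part of `f`. -/
theorem exists_pushforward (hG : IsSurfaceGroup G) (hG' : IsSurfaceGroup G')
    (hD : IsOpen D) (hf : ContinuousOn f D) {ρ : Surface G → ℝ≥0∞} (hρ : Measurable ρ)
    {B : Set ℂ} (hB : MeasurableSet B) (hBr : B ⊆ regularSet f D) (hinj : InjOn (coordMap f) B) :
    ∃ R : Surface G' → ℝ≥0∞, Measurable R ∧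
      (∀ z ∈ B, R (f (projC G z)) = invStretch f z * ρ (projC G z)) ∧
      ∫⁻ q, R q ^ 2 ∂(area G') ≤ ∫⁻ z in B, ENNReal.ofReal (hypDensity z ^ 2) *
        (dilatation f (projC G z) * ρ (projC G z) ^ 2) := by
  have : T2Space (Surface G') := by
    let := hG'.metricSpace
    infer_instance
  have hBΩ : B ⊆ coordDomain f D := fun z hz => (hBr hz).1
  have hBb : B ⊆ Metric.ball 0 1 := fun z hz => dirichletC_subset_ball (hBΩ hz).1
  have hcont : ContinuousOn (fun z => f (projC G z)) B :=
    hf.comp (continuousOn_projC.mono hBb) fun z hz => (hBΩ hz).2.1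
  have hinj' : InjOn (fun z => f (projC G z)) B := fun z hz w hw h =>
    hinj hz hw (congrArg (sectionC G') h)
  have hemb := hcont.measurableEmbedding hB hinj'
  set k : B → ℝ≥0∞ := fun z => invStretch f z * ρ (projC G z) with hk
  have hkm : Measurable k := by
    have h1 : Measurable fun z : B => invStretch f z := measurable_invStretch fun z hz =>
      (hBr hz).2.1.continuousAt.continuousWithinAt
    have h2 : Measurable fun z : B => projC G z :=
      (continuousOn_iff_continuous_domRestrict.1 (continuousOn_projC.mono hBb)).measurable
    exact h1.mul (hρ.comp h2)
  -- Extension by 0 off the image of the piece; an injective continuous image of a Borel set is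
  -- Borel, which keeps R measurable.
  set R : Surface G' → ℝ≥0∞ :=
    Function.extend (B.domRestrict fun z => f (projC G z)) k 0 with hR
  have hRB : ∀ z ∈ B, R (f (projC G z)) = invStretch f z * ρ (projC G z) := fun z hz =>
    hemb.injective.extend_apply k 0 ⟨z, hz⟩
  refine ⟨R, hemb.measurable_extend hkm measurable_const, hRB, ?_⟩
  have hd : ∀ z ∈ B, HasFDerivWithinAt (coordMap f) (fderiv ℝ (coordMap f) z) B z := fun z hz =>
    (hBr hz).2.1.hasFDerivAt.hasFDerivWithinAt
  have hIm : MeasurableSet (coordMap f '' B) := by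
    have := (measurableEmbedding_of_fderivWithin hB hd hinj).measurableSet_range
    rwa [range_domRestrict] at this
  have hsub : coordMap f '' B ⊆ dirichletC G' := by
    rintro _ ⟨z, hz, rfl⟩; exact coordMap_mem (hBΩ hz)
  have hzero : ∀ w ∈ dirichletC G', w ∉ coordMap f '' B → R (projC G' w) = 0 := by
    intro w hw hwB
    refine Function.extend_apply' _ _ _ ?_
    rintro ⟨⟨z, hz⟩, he⟩
    refine hwB ⟨z, hz, ?_⟩
    have he : f (projC G z) = projC G' w := he
    rw [coordMap, he, hG'.sectionC_projC hw]
  calc ∫⁻ q, R q ^ 2 ∂(area G')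
      = ∫⁻ w in dirichletC G', ENNReal.ofReal (hypDensity w ^ 2) * R (projC G' w) ^ 2 :=
        hG'.lintegral_area _
    _ = ∫⁻ w in coordMap f '' B, ENNReal.ofReal (hypDensity w ^ 2) * R (projC G' w) ^ 2 := by
        conv_rhs => rw [← inter_eq_left.2 hsub]
        rw [← setLIntegral_indicator hIm]
        refine setLIntegral_congr_fun hG'.isOpen_dirichletC.measurableSet fun w hw => ?_
        by_cases h : w ∈ coordMap f '' B
        · simp [h]
        · simp [h, hzero w hw h]
    _ = ∫⁻ z in B, ENNReal.ofReal |(fderiv ℝ (coordMap f) z).det| *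
          (ENNReal.ofReal (hypDensity (coordMap f z) ^ 2) * R (projC G' (coordMap f z)) ^ 2) :=
        lintegral_image_eq_lintegral_abs_det_fderiv_mul volume hB hd hinj _
    _ ≤ _ := by
        refine setLIntegral_mono' hB fun z hz => ?_
        have hκ := hypDensity_pos (norm_lt_one_of_mem_dirichletC (hBΩ hz).1)
        have hκ' := hypDensity_pos (norm_lt_one_of_mem_dirichletC (coordMap_mem (hBΩ hz)))
        have hl := minStretch_pos (hBr hz).2.2
        have hK := le_dilatation hG hG' hD hf (hBΩ hz)
        rw [linDilatation_eq (hBr hz).2.2] at hK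
        -- With densities κ, κ' at z and its image, the pointwise identity is |det| κ'² (κ/(κ' l))²
        -- = κ² |det|/l².
        rw [projC_coordMap (hBΩ hz), hRB z hz, mul_pow, invStretch,
          ← ENNReal.ofReal_pow (by positivity), ← mul_assoc, ← mul_assoc,
          ← ENNReal.ofReal_mul (by positivity), ← ENNReal.ofReal_mul (by positivity), ← mul_assoc]
        refine mul_le_mul_left ?_ _
        refine le_trans (le_of_eq ?_) (mul_le_mul_right hK _)
        rw [← ENNReal.ofReal_mul (by positivity)]
        congr 1
        field_simp
/-- The test function on the image surface: it is infinite on a null set `E` which contains the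
image of all points that are not regular. -/
theorem exists_testFunction (hG : IsSurfaceGroup G) (hG' : IsSurfaceGroup G')
    (hD : IsOpen D) (hf : ContinuousOn f D) (hfD : f '' D = D') (hdiff : AEDifferentiable f D)
    (hN : LusinN f D) (hNinv : LusinNInv f D D') {ρ : Surface G → ℝ≥0∞} (hρ : Measurable ρ) :
    ∃ (E : Set (Surface G')) (R : Surface G' → ℝ≥0∞), Measurable R ∧ (∀ q ∈ E, R q = ∞) ∧
      (∀ p ∈ D, f p ∉ E → ∃ z ∈ regularSet f D, projC G z = p) ∧
      (∀ z ∈ regularSet f D, invStretch f z * ρ (projC G z) ≤ R (f (projC G z))) ∧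
      ∫⁻ q, R q ^ 2 ∂(area G') ≤ ∫⁻ p in D, dilatation f p * ρ p ^ 2 ∂(area G) := by
  have hnull : area G' (f '' (D \ projC G '' regularSet f D)) = 0 :=
    hN _ sdiff_subset (area_diff_regularSet hG hG' hD hf hfD hdiff hNinv)
  -- A Borel hull of the null image, so that the value ∞ on it keeps the test function Borel.
  set E := toMeasurable (area G') (f '' (D \ projC G '' regularSet f D)) with hE
  have hE0 : area G' E = 0 := by rw [hE, measure_toMeasurable, hnull]
  have hEm : MeasurableSet E := measurableSet_toMeasurable _ _
  obtain ⟨t, htd, htm, hts, hti⟩ := exists_partition_injOn (s := regularSet f D)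
    (fun z hz => hz.2.1.hasFDerivAt) fun z hz => hz.2.2
  have hreg := measurableSet_regularSet hG hG' hD hf
  choose R hRm hRB hRi using fun n => exists_pushforward hG hG' hD hf hρ (hreg.inter (htm n))
    inter_subset_left (hti n)
  refine ⟨E, fun q => E.indicator (fun _ => ∞) q ⊔ ⨆ n, R n q, ?_, ?_, ?_, ?_, ?_⟩
  · exact (measurable_const.indicator hEm).sup (.iSup hRm)
  · intro q hq
    simp [hq]
  · intro p hp hpE
    by_contra hcon
    refine hpE (subset_toMeasurable _ _ ⟨p, ⟨hp, ?_⟩, rfl⟩)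
    rintro ⟨z, hz, hzp⟩
    exact hcon ⟨z, hz, hzp⟩
  · intro z hz
    obtain ⟨n, hn⟩ := mem_iUnion.1 (hts hz)
    rw [← hRB n z ⟨hz, hn⟩]
    exact (le_iSup (fun n => R n (f (projC G z))) n).trans le_sup_right
  · set H : ℂ → ℝ≥0∞ := fun z => ENNReal.ofReal (hypDensity z ^ 2) *
      (dilatation f (projC G z) * ρ (projC G z) ^ 2) with hH
    have hDm : MeasurableSet (dirichletC G ∩ projC G ⁻¹' D) :=
      ((continuousOn_projC.mono dirichletC_subset_ball).isOpen_inter_preimage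
        hG.isOpen_dirichletC hD).measurableSet
    -- Off the null set E, the square of the supremum over the pieces is at most the sum of the
    -- squares.
    calc ∫⁻ q, (E.indicator (fun _ => ∞) q ⊔ ⨆ n, R n q) ^ 2 ∂(area G')
        ≤ ∫⁻ q, ∑' n, R n q ^ 2 ∂(area G') := by
          refine lintegral_mono_ae ?_
          have : ∀ᵐ q ∂(area G'), q ∉ E := measure_eq_zero_iff_ae_notMem.1 hE0
          filter_upwards [this] with q hq
          rw [indicator_of_notMem hq, max_eq_right zero_le, ENNReal.iSup_pow_of_ne_zero two_ne_zero]
          exact iSup_le fun n => ENNReal.le_tsum n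
      _ = ∑' n, ∫⁻ q, R n q ^ 2 ∂(area G') :=
          lintegral_tsum fun n => ((hRm n).pow_const 2).aemeasurable
      _ ≤ ∑' n, ∫⁻ z in regularSet f D ∩ t n, H z := ENNReal.tsum_le_tsum hRi
      _ = ∫⁻ z in ⋃ n, regularSet f D ∩ t n, H z :=
          (lintegral_iUnion (fun n => hreg.inter (htm n))
            (fun i j hij => (htd hij).mono inter_subset_right inter_subset_right) _).symm
      _ ≤ ∫⁻ z in dirichletC G ∩ projC G ⁻¹' D, H z := by
          refine lintegral_mono_set (iUnion_subset fun n z hz => ?_)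
          exact ⟨hz.1.1.1, hz.1.1.2.1⟩
      _ = ∫⁻ p in D, dilatation f p * ρ p ^ 2 ∂(area G) := by
          rw [← lintegral_indicator hD.measurableSet, hG.lintegral_area,
            ← inter_eq_left.2 (inter_subset_left (s := dirichletC G) (t := projC G ⁻¹' D)),
            ← setLIntegral_indicator hDm]
          refine setLIntegral_congr_fun hG.isOpen_dirichletC.measurableSet fun z hz => ?_
          by_cases hzD : projC G z ∈ D
          · simp [hz, hzD, hH]
          · simp [hzD]

end TestFunction

/-! ### Line integrals along a curve on the surface and along its image -/

section Curves

variable {G G' : Subgroup (Equiv.Perm 𝔻)}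

theorem Curve.length_eq_eVariationOn (hG : IsSurfaceGroup G) (γ : Curve (Surface G)) (s t : ℝ) :
    γ.length s t = let := hG.metricSpace; eVariationOn γ.toFun (Icc s t) := by
  let := hG.metricSpace
  change _ = eVariationOn γ.toFun (Icc s t)
  unfold Curve.length eVariationOn
  refine iSup_congr fun p => Finset.sum_congr rfl fun i _ => ?_
  rw [edist_comm, edist_dist]
  rfl

theorem Curve.integral_mono (γ : Curve (Surface G)) {ρ η : Surface G → ℝ≥0∞}
    (h : ∀ p, ρ p ≤ η p) : γ.integral ρ ≤ γ.integral η :=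
  iSup₂_mono fun _ _ => iSup₂_mono fun _ _ => iSup_mono fun _ => lintegral_mono fun _ => h _

/-- The integral of `ρ` along a lifting is at most that of the test function along the curve. -/
theorem Curve.integral_le_of_isImageCurve (hG : IsSurfaceGroup G) (hG' : IsSurfaceGroup G')
    {D : Set (Surface G)} {f : Surface G → Surface G'} {γ : Curve (Surface G)}
    {γ' : Curve (Surface G')} (hD : γ.In D) (hγγ' : IsImageCurve f γ γ')
    (hγ : γ.LocallyRectifiable) (hγ' : γ'.LocallyRectifiable) (hac : InverseLengthAC γ γ')
    {E : Set (Surface G')} {ψ ρ : Surface G → ℝ≥0∞} {R : Surface G' → ℝ≥0∞}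
    (hRm : Measurable R) (hRE : ∀ q ∈ E, R q = ∞)
    (hloc : ∀ p ∈ D, f p ∉ E → ∀ c : NNReal, ψ p < c →
      ∀ᶠ p' in 𝓝 p, p' ∈ D → surfDist p' p ≤ c * surfDist (f p') (f p))
    (hR : ∀ p ∈ D, f p ∉ E → ψ p * ρ p ≤ R (f p)) :
    γ.integral ρ ≤ γ'.integral R := by
  let := hG.metricSpace
  let := hG'.metricSpace
  refine iSup₂_le fun s hs => iSup₂_le fun t ht => iSup_le fun hst => ?_
  have hdom : γ'.dom = γ.dom := hγγ'.1
  refine le_trans ?_ (le_iSup₂_of_le s (hdom ▸ hs) (le_iSup₂_of_le t (hdom ▸ ht)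
    (le_iSup_of_le hst le_rfl)))
  have hsub : Icc s t ⊆ γ.dom := γ.ordConnected.out hs ht
  have hα : eVariationOn γ.toFun (Icc s t) ≠ ∞ :=
    γ.length_eq_eVariationOn hG s t ▸ (hγ s hs t ht hst).ne
  have hβ : eVariationOn γ'.toFun (Icc s t) ≠ ∞ :=
    γ'.length_eq_eVariationOn hG' s t ▸ (hγ' s (hdom ▸ hs) t (hdom ▸ ht) hst).ne
  have hαc : ContinuousOn γ.toFun (Icc s t) := γ.continuousOn.mono hsub
  have hβc : ContinuousOn γ'.toFun (Icc s t) := γ'.continuousOn.mono (hdom ▸ hsub)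
  have lα : ∀ u, (γ.length s u).toReal = arcLength γ.toFun s u := fun u => by
    rw [γ.length_eq_eVariationOn hG]; rfl
  have lβ : ∀ u, (γ'.length s u).toReal = arcLength γ'.toFun s u := fun u => by
    rw [γ'.length_eq_eVariationOn hG']; rfl
  have fα : ∀ u ∈ Icc s t, γ.lengthFun s u = arcLength γ.toFun s u := fun u hu => by
    rw [Curve.lengthFun, if_pos hu.1, lα]
  have fβ : ∀ u ∈ Icc s t, γ'.lengthFun s u = arcLength γ'.toFun s u := fun u hu => by
    rw [Curve.lengthFun, if_pos hu.1, lβ]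
  have iα : (fun u => γ.lengthFun s u) '' Icc s t = Icc 0 (arcLength γ.toFun s t) := by
    rw [← arcLength_image_Icc hst hα hαc]
    exact image_congr fα
  have iβ : (fun u => γ'.lengthFun s u) '' Icc s t = Icc 0 (arcLength γ'.toFun s t) := by
    rw [← arcLength_image_Icc hst hβ hβc]
    exact image_congr fβ
  -- Taking the base point s makes both length functions start at 0, so v is absolutely continuous
  -- on exactly the segment [0, length of γ' over [s, t]].
  obtain ⟨v, hv, hvac⟩ := hac s hs
  rw [lα, lβ]
  have key := lintegral_arcLength_le_of_lift hst hαc hβc hα hβ (v := v) (D := D) (E := E) (ψ := ψ)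
    (ρ := ρ) (R := R) (f := f)
    (σα := Function.invFunOn (fun u => γ.lengthFun s u) (Icc s t))
    (σβ := Function.invFunOn (fun u => γ'.lengthFun s u) (Icc s t))
    (hvac _ _ (arcLength_nonneg _ _ _) (iβ ▸ image_mono hsub))
    (fun u hu => by rw [← fβ u hu, ← fα u hu]; exact hv u (hsub hu))
    (fun r hr => by
      rw [← iα] at hr
      have hm := Function.invFunOn_mem hr
      exact ⟨hm, by rw [← fα _ hm]; exact Function.invFunOn_eq hr⟩)
    (fun r hr => by
      rw [← iβ] at hr
      have hm := Function.invFunOn_mem hr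
      exact ⟨hm, by rw [← fβ _ hm]; exact Function.invFunOn_eq hr⟩)
    (fun u hu => hγγ'.2 u (hsub hu)) (fun u hu => hD u (hsub hu)) hRm hRE hloc hR
  exact key

end Curves

/-- The modulus inequality for mappings of class `ACP⁻¹` with the Lusin properties. -/
theorem modulus_imageFamily_le {G G' : Subgroup (Equiv.Perm 𝔻)} (hG : IsSurfaceGroup G)
    (hG' : IsSurfaceGroup G') {D : Set (Surface G)} {D' : Set (Surface G')} (hDo : IsOpen D)
    {f : Surface G → Surface G'} (hf : ContinuousOn f D) (hfD : f '' D = D')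
    (hdiff : AEDifferentiable f D) (hacp : ACPInv f D) (hN : LusinN f D)
    (hNinv : LusinNInv f D D') {Γ : Set (Curve (Surface G))} (hΓ : ∀ γ ∈ Γ, γ.In D)
    {ρ : Surface G → ℝ≥0∞} (hρ : ρ ∈ adm Γ) :
    modulus (imageFamily f Γ) ≤ ∫⁻ p in D, dilatation f p * ρ p ^ 2 ∂(area G) := by
  obtain ⟨E, R, hRm, hRE, hreg, hRρ, hRi⟩ :=
    exists_testFunction hG hG' hDo hf hfD hdiff hN hNinv hρ.1
  refine ENNReal.le_of_forall_pos_le_add fun ε hε _ => ?_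
  -- Modulus zero supplies an admissible η of energy below ε for the exceptional curves.
  have hbad : modulus _ < (ε : ℝ≥0∞) := hacp.2.trans_lt (by exact_mod_cast hε)
  obtain ⟨η, hη⟩ := iInf_lt_iff.1 hbad
  obtain ⟨hηadm, hηi⟩ := iInf_lt_iff.1 hη
  -- A curve with good liftings is handled by R, an exceptional one by η.
  have hadm : (fun q => R q ⊔ η q) ∈ adm (imageFamily f Γ) := by
    refine ⟨hRm.sup hηadm.1, ?_⟩
    rintro γ' ⟨γ, hγ, hγγ'⟩ hγ'
    by_cases hP : ∀ γ : Curve (Surface G), γ.In D → IsImageCurve f γ γ' →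
        γ.LocallyRectifiable ∧ InverseLengthAC γ γ'
    · obtain ⟨hr, hac⟩ := hP γ (hΓ γ hγ) hγγ'
      refine (hρ.2 γ hγ hr).trans (le_trans ?_ (γ'.integral_mono fun q => le_max_left _ _))
      refine Curve.integral_le_of_isImageCurve hG hG' (hΓ γ hγ) hγγ' hr hγ' hac hRm hRE
        (ψ := fun p => invStretch f (sectionC G p)) ?_ ?_
      · intro p hp hpE c hc
        obtain ⟨z, hz, rfl⟩ := hreg p hp hpE
        simp only [hG.sectionC_projC hz.1.1] at hc
        filter_upwards [eventually_surfDist_le hG hG' hDo hf hz.1 hz.2.1 hz.2.2 hc] with p' h _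
          using h
      · intro p hp hpE
        obtain ⟨z, hz, rfl⟩ := hreg p hp hpE
        simp only [hG.sectionC_projC hz.1.1]
        exact hRρ z hz
    · refine (hηadm.2 γ' ⟨fun t ht => ?_, hP⟩ hγ').trans
        (γ'.integral_mono fun q => le_max_right _ _)
      have ht' : t ∈ γ.dom := hγγ'.1 ▸ ht
      exact ⟨γ.toFun t, hΓ γ hγ t ht', (hγγ'.2 t ht').symm⟩
  calc modulus (imageFamily f Γ) ≤ ∫⁻ q, (R q ⊔ η q) ^ 2 ∂(area G') := iInf₂_le _ hadm
    _ ≤ ∫⁻ q, R q ^ 2 + η q ^ 2 ∂(area G') := by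
        refine lintegral_mono fun q => ?_
        rcases le_total (R q) (η q) with h | h
        · simp only [max_eq_right h]; exact le_add_self
        · simp only [max_eq_left h]; exact le_self_add
    _ = ∫⁻ q, R q ^ 2 ∂(area G') + ∫⁻ q, η q ^ 2 ∂(area G') :=
        lintegral_add_left (hRm.pow_const 2) _
    _ ≤ _ := add_le_add hRi hηi.le

end HypModulus

theorem mainTheorem1
    (G G' : Subgroup (Equiv.Perm Complex.UnitDisc))
    (hG : HypModulus.IsSurfaceGroup G) (hG' : HypModulus.IsSurfaceGroup G')
    (D : Set (HypModulus.Surface G)) (D' : Set (HypModulus.Surface G'))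
    (hDo : IsOpen D) (hDc : IsConnected D) (hDk : IsCompact (closure D))
    (hDo' : IsOpen D') (hDc' : IsConnected D') (hDk' : IsCompact (closure D'))
    (f : HypModulus.Surface G → HypModulus.Surface G')
    (hf : ContinuousOn f D) (hfD : f '' D = D')
    (hdiff : HypModulus.AEDifferentiable f D)
    (hacp : HypModulus.ACPInv f D)
    (hN : HypModulus.LusinN f D) (hNinv : HypModulus.LusinNInv f D D')
    (Γ : Set (HypModulus.Curve (HypModulus.Surface G))) (hΓ : ∀ γ ∈ Γ, γ.In D)
    (ρ : HypModulus.Surface G → ENNReal) (hρ : ρ ∈ HypModulus.adm Γ) :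
    HypModulus.modulus (HypModulus.imageFamily f Γ) ≤
      ∫⁻ p in D, HypModulus.dilatation f p * ρ p ^ 2 ∂(HypModulus.area G) :=
  HypModulus.modulus_imageFamily_le hG hG' hDo hf hfD hdiff hacp hN hNinv hΓ hρ
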